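/- Let $G$ be a finite connected graph embedded on an oriented torus so that every face is a disc of degree $4$. A \emph{rhombic embedding} of $G$ is a flat torus $\mathbb{R}^2/\Lambda$ (the lattice $\Lambda$ may depend on the embedding) together with an embedding of $G$ in it, respecting the orientation and with the same faces, such that every edge is a straight segment of length $1$ (so that every face is a rhombus). A \emph{wedge} is a corner of a face at one of its vertices; a rhombic embedding assigns to each wedge an angle in $(0,\pi)$. Let $W$ be the set of wedges and let $\mathrm{Rh}(G)\subset(0,\pi)^W$ be the set of all angle functions of rhombic embeddings of $G$. An \emph{oriented train track} is a closed path of faces which leaves each face through the edge opposite to the one through which it entered. In a rhombic embedding all edges crossed by an oriented train track $t$ are parallel to a fixed unit vector $u(t)$, pointing from the right of $t$ to its left, called its \emph{transversal}. The \emph{asymptotic vector} $v(t)$ is the difference in $\mathbb{R}^2$ between two consecutive lifts of a point of $t$ to the universal cover; it is nonzero, and the \emph{asymptotic direction} is $a(t)=v(t)/\|v(t)\|$. \textbf{Theorem.} Suppose that $G$ has at least one rhombic embedding. Then: \begin{enumerate} \item The set $\mathrm{Rh}(G)$ is convex, the area of the torus $\mathbb{R}^2/\Lambda$ of a rhombic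 embedding depends only on its angle function, and the area is a strictly concave function on $\mathrm{Rh}(G)$. \item There is a rhombic embedding whose torus has maximal area among all rhombic embeddings of $G$, and it is unique up to an orientation-preserving isometry (a map $z\mapsto cz+w$ with $|c|=1$). \item A rhombic embedding of $G$ has maximal area if and only if, for every train track $t$, the transversal $u(t)$ is orthogonal to the asymptotic direction $a(t)$. \end{enumerate} -/

import Mathlib

/-- A finite graph embedded on an oriented torus with all faces (topological discs) of degree `4`,
as a combinatorial map.  `D` is the set of darts (oriented edges).  `rev` reverses a dart, and
`next d` is the dart following `d` along the boundary of the face to the left of `d`, the boundary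
being traversed counterclockwise. -/
structure TorusQuadrangulation (D : Type*) [Fintype D] where
  rev : Equiv.Perm D
  next : Equiv.Perm D
  rev_rev : ∀ d, rev (rev d) = d
  rev_ne : ∀ d, rev d ≠ d
  /-- every face has degree four -/
  face_degree : ∀ d, Function.minimalPeriod next d = 4
  nonempty : Nonempty D
  /-- the graph is connected -/
  connected : MulAction.IsPretransitive (Subgroup.closure {rev, next}) D
  /-- Euler characteristic zero: vertices plus faces equals edges, where the vertices are the
  cycles of the rotation `d ↦ rev (next⁻¹ d)` -/
  euler : Nat.card (Quotient (Equiv.Perm.SameCycle.setoid (rev * next⁻¹)))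
      + Nat.card (Quotient (Equiv.Perm.SameCycle.setoid next))
      = Nat.card (Quotient (Equiv.Perm.SameCycle.setoid rev))

namespace TorusQuadrangulation

variable {D : Type*} [Fintype D]

/-- The next dart, counterclockwise, with the same tail.  The wedge (corner) at the tail of `d` in
the face to the left of `d` lies between `d` and `rot d`; thus wedges are indexed by darts. -/
def rot (G : TorusQuadrangulation D) : Equiv.Perm D := G.rev * G.next⁻¹

def Vertex (G : TorusQuadrangulation D) : Type _ :=
  Quotient (Equiv.Perm.SameCycle.setoid G.rot)

/-- The tail vertex of a dart; the head is `G.tail (G.rev d)`. -/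
def tail (G : TorusQuadrangulation D) (d : D) : G.Vertex :=
  Quotient.mk (Equiv.Perm.SameCycle.setoid G.rot) d

/-- The train track step: enter the face to the left of `d` through `d`, and leave it through the
opposite edge, described as a dart having the next face on its left. -/
def cross (G : TorusQuadrangulation D) : Equiv.Perm D := G.rev * G.next * G.next

/-- Oriented train tracks. -/
def OrientedTrainTrack (G : TorusQuadrangulation D) : Type _ :=
  Quotient (Equiv.Perm.SameCycle.setoid G.cross)

/-- The oriented train track which enters the face to the left of `d` through `d`. -/
def track (G : TorusQuadrangulation D) (d : D) : G.OrientedTrainTrack :=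
  Quotient.mk (Equiv.Perm.SameCycle.setoid G.cross) d

/-- A straight-line drawing with unit edges on the flat torus `ℂ ⧸ Λ`: each vertex has a position,
and the dart `d` is drawn as the path `s ↦ pos (tail d) + s • edge d`, `0 ≤ s ≤ 1`. -/
structure UnitDrawing (G : TorusQuadrangulation D) where
  Λ : Submodule ℤ ℂ
  discrete : DiscreteTopology Λ
  lattice : IsZLattice ℝ Λ
  pos : G.Vertex → ℂ ⧸ Λ.toAddSubgroup
  edge : D → ℂ
  norm_edge : ∀ d, ‖edge d‖ = 1
  edge_rev : ∀ d, edge (G.rev d) = -edge d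
  pos_head : ∀ d, pos (G.tail (G.rev d)) =
    pos (G.tail d) + (QuotientAddGroup.mk (edge d) : ℂ ⧸ Λ.toAddSubgroup)

namespace UnitDrawing

variable {G : TorusQuadrangulation D}

/-- The point of the torus at parameter `s` on the dart `d`. -/
def edgePoint (R : UnitDrawing G) (d : D) (s : ℝ) : ℂ ⧸ R.Λ.toAddSubgroup :=
  R.pos (G.tail d) + QuotientAddGroup.mk ((s : ℂ) * R.edge d)

/-- The point with coordinates `(s, t)` of the parallelogram which has a corner at the tail of `d`
and sides `edge d`, `edge (rot d)` there: the face to the left of `d`. -/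
def facePoint (R : UnitDrawing G) (d : D) (s t : ℝ) : ℂ ⧸ R.Λ.toAddSubgroup :=
  R.pos (G.tail d) + QuotientAddGroup.mk ((s : ℂ) * R.edge d + (t : ℂ) * R.edge (G.rot d))

end UnitDrawing

/-- A rhombic embedding of `G` on a flat torus (which may depend on the embedding): the graph is
embedded by straight edges of length one, and the faces of the embedding are the faces of `G`,
positively oriented and realized as rhombi. -/
structure RhombicEmbedding (G : TorusQuadrangulation D) extends UnitDrawing G where
  /-- distinct vertices have distinct positions -/
  pos_injective : Function.Injective pos
  /-- the open edges do not meet the vertices -/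
  edge_vertex : ∀ (d : D) (v : G.Vertex), ∀ s ∈ Set.Ioo (0 : ℝ) 1,
    toUnitDrawing.edgePoint d s ≠ pos v
  /-- the open edges are simple and pairwise disjoint -/
  edge_edge : ∀ d d' : D, ∀ s ∈ Set.Ioo (0 : ℝ) 1, ∀ s' ∈ Set.Ioo (0 : ℝ) 1,
    toUnitDrawing.edgePoint d s = toUnitDrawing.edgePoint d' s' →
      (d' = d ∧ s' = s) ∨ (d' = G.rev d ∧ s' = 1 - s)
  /-- the boundary of a face closes up to a parallelogram in the plane -/
  face_closed : ∀ d, edge (G.next (G.next d)) = -edge d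
  /-- faces are nondegenerate and positively oriented -/
  face_pos : ∀ d, 0 < (edge (G.rot d) / edge d).im
  /-- the interior of each rhombus is embedded in the torus -/
  face_injective : ∀ d : D, ∀ s ∈ Set.Ioo (0 : ℝ) 1, ∀ t ∈ Set.Ioo (0 : ℝ) 1,
    ∀ s' ∈ Set.Ioo (0 : ℝ) 1, ∀ t' ∈ Set.Ioo (0 : ℝ) 1,
      toUnitDrawing.facePoint d s t = toUnitDrawing.facePoint d s' t' → s = s' ∧ t = t'
  /-- the interiors of distinct faces are disjoint -/
  face_disjoint : ∀ d d' : D, ¬ G.next.SameCycle d d' →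
    ∀ s ∈ Set.Ioo (0 : ℝ) 1, ∀ t ∈ Set.Ioo (0 : ℝ) 1,
    ∀ s' ∈ Set.Ioo (0 : ℝ) 1, ∀ t' ∈ Set.Ioo (0 : ℝ) 1,
      toUnitDrawing.facePoint d s t ≠ toUnitDrawing.facePoint d' s' t'
  /-- the closed faces cover the torus -/
  face_cover : ∀ x : ℂ ⧸ Λ.toAddSubgroup, ∃ d : D, ∃ s ∈ Set.Icc (0 : ℝ) 1,
    ∃ t ∈ Set.Icc (0 : ℝ) 1, toUnitDrawing.facePoint d s t = x

namespace RhombicEmbedding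

variable {G : TorusQuadrangulation D}

/-- The rhombus angle at the wedge between `d` and `rot d`; it lies in `(0, π)`. -/
noncomputable def angle (R : RhombicEmbedding G) (d : D) : ℝ :=
  (R.edge (G.rot d) / R.edge d).arg

/-- The area of the flat torus carrying the embedding. -/
noncomputable def area (R : RhombicEmbedding G) : ℝ :=
  haveI := R.discrete
  haveI := R.lattice
  ZLattice.covolume R.Λ MeasureTheory.volume

def IsAreaMaximizer (R : RhombicEmbedding G) : Prop :=
  ∀ R' : RhombicEmbedding G, R'.area ≤ R.area

/-- The two embeddings differ by an orientation-preserving isometry `z ↦ c * z + w` of the plane,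
which induces an isometry between the two tori. -/
def Congruent (R R' : RhombicEmbedding G) : Prop :=
  ∃ c w : ℂ, ‖c‖ = 1 ∧ (∀ z : ℂ, z ∈ R.Λ ↔ c * z ∈ R'.Λ) ∧
    (∀ d, R'.edge d = c * R.edge d) ∧
    (∀ (v : G.Vertex) (z : ℂ), (QuotientAddGroup.mk z : ℂ ⧸ R.Λ.toAddSubgroup) = R.pos v →
      (QuotientAddGroup.mk (c * z + w) : ℂ ⧸ R'.Λ.toAddSubgroup) = R'.pos v)

theorem edge_cross (R : RhombicEmbedding G) (d : D) : R.edge (G.cross d) = R.edge d := by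
  simp [cross, R.edge_rev, R.face_closed]

theorem edge_eq_of_sameCycle (R : RhombicEmbedding G) {d d' : D} (h : G.cross.SameCycle d d') :
    R.edge d' = R.edge d := by
  obtain ⟨n, -, hn⟩ := h.exists_pow_eq'
  have key : ∀ n : ℕ, R.edge ((G.cross ^ n) d) = R.edge d := by
    intro n
    induction n with
    | zero => simp
    | succ k ih => rw [pow_succ', Equiv.Perm.mul_apply, edge_cross, ih]
  rw [← hn, key]

/-- The transversal of an oriented train track: the common unit vector of the edges which it
crosses, pointing from the right of the track to its left.  (The track moves to the left of `d`.) -/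
def transversal (R : RhombicEmbedding G) (t : G.OrientedTrainTrack) : ℂ :=
  Quotient.lift (fun d => -R.edge d)
    (fun _ _ h => congrArg Neg.neg (R.edge_eq_of_sameCycle h).symm) t

open Classical in
/-- The displacement in the plane between two consecutive lifts of a point of the train track:
the sum over one period of the displacements from the midpoint of `d` to the midpoint of the
opposite edge of the face to the left of `d`. -/
noncomputable def asymptoticVector (R : RhombicEmbedding G) (t : G.OrientedTrainTrack) : ℂ :=
  ∑ d : D with G.track d = t,
    (R.edge d / 2 + R.edge (G.next d) + R.edge (G.next (G.next d)) / 2)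

theorem asymptoticVector_ne_zero (R : RhombicEmbedding G) (t : G.OrientedTrainTrack) :
    R.asymptoticVector t ≠ 0 := by
  classical
  induction t using Quotient.inductionOn with
  | h d =>
  have hpos : 0 < (R.asymptoticVector (G.track d) / R.edge d).im := by
    rw [asymptoticVector, Finset.sum_div, Complex.im_sum]
    refine Finset.sum_pos ?_ ⟨d, by simp⟩
    intro d' hd'
    have hc : G.cross.SameCycle d' d := Quotient.exact (Finset.mem_filter.1 hd').2
    rw [R.edge_eq_of_sameCycle hc, R.face_closed]
    have h := R.face_pos (G.next d')
    have h1 : G.rot (G.next d') = G.rev d' := by simp [rot]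
    rw [h1, R.edge_rev] at h
    have h2 : R.edge d' / 2 + R.edge (G.next d') + -R.edge d' / 2 = R.edge (G.next d') := by ring
    rw [h2]
    have n1 : Complex.normSq (R.edge d') = 1 := by
      rw [Complex.normSq_eq_norm_sq, R.norm_edge]; norm_num
    have n2 : Complex.normSq (R.edge (G.next d')) = 1 := by
      rw [Complex.normSq_eq_norm_sq, R.norm_edge]; norm_num
    rw [Complex.div_im] at h ⊢
    simp only [n1, n2, Complex.neg_im, Complex.neg_re, div_one] at h ⊢
    linarith
  intro h0
  change R.asymptoticVector (G.track d) = 0 at h0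
  rw [h0] at hpos
  simp at hpos

/-- The asymptotic direction of an oriented train track, a unit vector. -/
noncomputable def asymptoticDirection (R : RhombicEmbedding G) (t : G.OrientedTrainTrack) : ℂ :=
  ‖R.asymptoticVector t‖⁻¹ • R.asymptoticVector t

end RhombicEmbedding

/-- The space of rhombic embeddings of `G` on a torus, parametrized by the rhombus angles. -/
def Rh (G : TorusQuadrangulation D) : Set (D → ℝ) :=
  Set.range (fun R : RhombicEmbedding G => R.angle)

end TorusQuadrangulation

/-! The edge vectors of a rhombic embedding form a function `e` on darts that is odd under reversal
and takes opposite values on opposite sides of each face, hence is constant along oriented tracks.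
Such a parallelogram cocycle `c` is a closed complex 1-cochain on the torus, and `pair` is the cup
product, which vanishes on coboundaries. Since `pair e (star e)` is a nonzero multiple of the area,
`e` and its conjugate are independent in cohomology. The first cohomology of a torus has dimension
two, so `c = a • e + b • star e` up to a coboundary (`IsRhombic.exists_combination`). Asymptotic
vectors and lattices then change by the real-linear map `z ↦ a * z + b * star z`, and areas by its
determinant `|a|² - |b|²`.

Realization (`RhombicEmbedding.exists_edge_eq`): every unit parallelogram cocycle with positively
oriented faces comes from an embedding once one embedding exists. The linear map transports the
lattice, and the coboundary corrects the vertex positions. The resulting faces are locally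
consistent, so they cover the torus by connectedness. Their total area equals the area of the torus,
so they cannot overlap, and injectivity of edges and vertices follows.

Convexity: when both cocycles are rhombic, the determinant is positive, so the asymptotic vectors
keep their pairwise orientation and turn by a controlled amount. This lifts the rotation of each
transversal from an angle modulo `2π` to a real number `β`, and the change of every wedge angle is a
difference of two values of `β`. Multiplying `β` by `s` interpolates the angles linearly. The area
is a quarter of the sum of the sines of the wedge angles, which is strictly concave.

Maximum: unit parallelogram cocycles form a compact set, so the area has a maximum there. Rotating
the edges of a single track changes the area by an affine function of its transversal, so at a
maximum each transversal is orthogonal to its track whenever the asymptotic vector is nonzero.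
Crossing tracks have positively oriented asymptotic vectors, so the maximizer is rhombic.
Conversely, under orthogonality the first variation of the sum of sines along every `β` vanishes,
and concavity makes the point a maximum.

Uniqueness: strict concavity makes the angles of maximizers equal. Equal angles give proportional
edge vectors, and the covering bound on the area forces the lattices to correspond. -/

namespace TorusQuadrangulation

variable {D : Type*} [Fintype D] (G : TorusQuadrangulation D)

/-! ### Combinatorics of darts, faces and tracks -/

section Combinatorics

theorem next_pow_four (d : D) : G.next (G.next (G.next (G.next d))) = d := by
  have h := Function.iterate_minimalPeriod (f := G.next) (x := d)
  rw [G.face_degree] at h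
  simpa using h

theorem next_symm_apply (d : D) : G.next⁻¹ d = G.next (G.next (G.next d)) := by
  rw [Equiv.Perm.inv_eq_iff_eq, G.next_pow_four]

theorem rot_apply (d : D) : G.rot d = G.rev (G.next (G.next (G.next d))) := by
  rw [rot, Equiv.Perm.mul_apply, next_symm_apply]

theorem rot_next (d : D) : G.rot (G.next d) = G.rev d := by simp [rot]

theorem cross_apply (d : D) : G.cross d = G.rev (G.next (G.next d)) := rfl

theorem cross_next (d : D) : G.cross (G.next d) = G.rot d := by
  rw [rot_apply, cross_apply]

theorem next_next_eq (d : D) : G.next (G.next d) = G.rev (G.cross d) := by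
  rw [cross_apply, G.rev_rev]

theorem next_cross_rev (d : D) : G.cross (G.rev (G.cross d)) = G.rev d := by
  rw [cross_apply, cross_apply, G.rev_rev, G.next_pow_four]

theorem tail_rot (d : D) : G.tail (G.rot d) = G.tail d := by
  refine Quotient.sound ?_
  change G.rot.SameCycle (G.rot d) d
  exact Equiv.Perm.sameCycle_apply_left.2 (Equiv.Perm.SameCycle.refl _ _)

theorem tail_next (d : D) : G.tail (G.next d) = G.tail (G.rev d) := by
  rw [← G.rot_next, tail_rot]

theorem track_cross (d : D) : G.track (G.cross d) = G.track d := by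
  refine Quotient.sound ?_
  change G.cross.SameCycle (G.cross d) d
  exact Equiv.Perm.sameCycle_apply_left.2 (Equiv.Perm.SameCycle.refl _ _)

theorem track_eq_iff {d d' : D} : G.track d = G.track d' ↔ G.cross.SameCycle d d' :=
  ⟨fun h => Quotient.exact h, fun h => Quotient.sound h⟩

/-- Two darts on the same track have reversals on the same track. -/
theorem track_rev_congr {d d' : D} (h : G.track d = G.track d') :
    G.track (G.rev d) = G.track (G.rev d') := by
  have key : ∀ (n : ℕ) (d : D), G.track (G.rev ((G.cross ^ n) d)) = G.track (G.rev d) := by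
    intro n d
    induction n with
    | zero => simp
    | succ k ih =>
      rw [pow_succ', Equiv.Perm.mul_apply, ← ih, ← track_cross, next_cross_rev]
  obtain ⟨n, -, hn⟩ := (G.track_eq_iff.1 h).exists_pow_eq'
  rw [← hn, key]

theorem eq_of_track_eq {α : Type*} {f : D → α} (hf : ∀ d, f (G.cross d) = f d) {d d' : D}
    (h : G.track d = G.track d') : f d = f d' := by
  have key : ∀ (n : ℕ), f ((G.cross ^ n) d) = f d := by
    intro n
    induction n with
    | zero => simp
    | succ k ih => rw [pow_succ', Equiv.Perm.mul_apply, hf, ih]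
  obtain ⟨n, -, hn⟩ := (G.track_eq_iff.1 h).exists_pow_eq'
  rw [← hn, key]

/-- A set of darts closed under reversal and passing to the next dart of a face is everything. -/
theorem dart_induction {p : D → Prop} (d₀ : D) (h₀ : p d₀) (hrev : ∀ d, p d → p (G.rev d))
    (hnext : ∀ d, p d → p (G.next d)) (d : D) : p d := by
  -- Connectedness is transitivity of a group, so inverses of the generators occur; here `next` has
  -- order four and `rev` order two.
  have hprev : ∀ d, p d → p (G.next⁻¹ d) := by
    intro d hd
    rw [next_symm_apply]
    exact hnext _ (hnext _ (hnext _ hd))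
  have hrev' : ∀ d, p d → p (G.rev⁻¹ d) := by
    intro d hd
    have : G.rev⁻¹ d = G.rev d := by rw [Equiv.Perm.inv_eq_iff_eq, G.rev_rev]
    rw [this]
    exact hrev _ hd
  obtain ⟨⟨g, hg⟩, rfl⟩ := G.connected.exists_smul_eq d₀ d
  change p (g d₀)
  have : ∀ x, p x → p (g x) := by
    induction hg using Subgroup.closure_induction'' with
    | mem x hx =>
      rcases hx with rfl | hx
      · exact hrev
      · rw [Set.mem_singleton_iff] at hx
        subst hx
        exact hnext
    | inv_mem x hx =>
      rcases hx with rfl | hx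
      · exact hrev'
      · rw [Set.mem_singleton_iff] at hx
        subst hx
        exact hprev
    | one => exact fun x hx => hx
    | mul x y _ _ hx hy => exact fun z hz => hx _ (hy z hz)
  exact this _ h₀

theorem eq_const {α : Type*} {f : D → α} (hrev : ∀ d, f (G.rev d) = f d)
    (hnext : ∀ d, f (G.next d) = f d) (d d' : D) : f d = f d' :=
  (G.dart_induction (p := fun x => f x = f d') d' rfl (fun x hx => (hrev x).trans hx)
    (fun x hx => (hnext x).trans hx) d)

end Combinatorics

/-! ### Parallelogram cocycles, the cup product and the area -/

/-- Complex functions on the darts which are antisymmetric under reversal and take opposite values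
on opposite sides of each face. -/
structure IsParallelogramCocycle (c : D → ℂ) : Prop where
  rev : ∀ d, c (G.rev d) = -c d
  opp : ∀ d, c (G.next (G.next d)) = -c d

/-- The coboundary of a function on the vertices. -/
def coboundary (g : G.Vertex → ℂ) (d : D) : ℂ := g (G.tail (G.rev d)) - g (G.tail d)

/-- The cup product pairing of cocycles. -/
def pair (c c' : D → ℂ) : ℂ := ∑ d, c d * c' (G.next d)

variable {G}

namespace IsParallelogramCocycle

variable {c c' : D → ℂ}

theorem cross (h : G.IsParallelogramCocycle c) (d : D) : c (G.cross d) = c d := by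
  rw [cross_apply, h.rev, h.opp, neg_neg]

theorem rot (h : G.IsParallelogramCocycle c) (d : D) : c (G.rot d) = c (G.next d) := by
  rw [← cross_next, h.cross]

theorem add (h : G.IsParallelogramCocycle c) (h' : G.IsParallelogramCocycle c') :
    G.IsParallelogramCocycle (c + c') :=
  ⟨fun d => by simp [h.rev, h'.rev]; ring, fun d => by simp [h.opp, h'.opp]; ring⟩

theorem smul (h : G.IsParallelogramCocycle c) (a : ℂ) : G.IsParallelogramCocycle (a • c) :=
  ⟨fun d => by simp [h.rev], fun d => by simp [h.opp]⟩

theorem neg (h : G.IsParallelogramCocycle c) : G.IsParallelogramCocycle (-c) :=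
  ⟨fun d => by simp [h.rev], fun d => by simp [h.opp]⟩

theorem star (h : G.IsParallelogramCocycle c) : G.IsParallelogramCocycle (star c) :=
  ⟨fun d => by simp [h.rev], fun d => by simp [h.opp]⟩

theorem track_congr (h : G.IsParallelogramCocycle c) {d d' : D} (hd : G.track d = G.track d') :
    c d = c d' := G.eq_of_track_eq h.cross hd

end IsParallelogramCocycle

theorem pair_add_left (c₁ c₂ c : D → ℂ) : G.pair (c₁ + c₂) c = G.pair c₁ c + G.pair c₂ c := by
  simp [pair, add_mul, Finset.sum_add_distrib]

theorem pair_add_right (c₁ c₂ c : D → ℂ) : G.pair c (c₁ + c₂) = G.pair c c₁ + G.pair c c₂ := by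
  simp [pair, mul_add, Finset.sum_add_distrib]

theorem pair_smul_left (a : ℂ) (c c' : D → ℂ) : G.pair (a • c) c' = a * G.pair c c' := by
  simp [pair, Finset.mul_sum, mul_assoc]

theorem pair_smul_right (a : ℂ) (c c' : D → ℂ) : G.pair c (a • c') = a * G.pair c c' := by
  simp [pair, Finset.mul_sum, mul_left_comm]

theorem pair_star (c c' : D → ℂ) : G.pair (star c) (star c') = star (G.pair c c') := by
  simp [pair]

/-- Shifting the sum by `next` exchanges the two factors, and `c` changes sign after two sides of a
face. Only the first argument has to be a cocycle. -/
theorem pair_antisymm {c c' : D → ℂ} (h : G.IsParallelogramCocycle c) :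
    G.pair c c' = -G.pair c' c := by
  unfold pair
  rw [← Equiv.sum_comp G.next (fun d => c' d * c (G.next d)), ← Finset.sum_neg_distrib]
  refine Finset.sum_congr rfl fun d _ => ?_
  rw [h.opp]; ring

theorem pair_self {c : D → ℂ} (h : G.IsParallelogramCocycle c) : G.pair c c = 0 :=
  self_eq_neg.1 (pair_antisymm h)

/-- Summation by parts: the head of `d` is the tail of `next d`, and around a vertex `rot` and
`next` give the same value of `c`. -/
theorem pair_coboundary {c : D → ℂ} (h : G.IsParallelogramCocycle c) (g : G.Vertex → ℂ) :
    G.pair (G.coboundary g) c = 0 := by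
  have h1 : G.pair (G.coboundary g) c
      = ∑ d, g (G.tail (G.next d)) * c (G.next d) - ∑ d, g (G.tail d) * c (G.next d) := by
    simp [pair, coboundary, sub_mul, tail_next]
  rw [h1, Equiv.sum_comp G.next (fun d => g (G.tail d) * c d),
    ← Equiv.sum_comp G.rot (fun d => g (G.tail d) * c d), sub_eq_zero]
  exact Finset.sum_congr rfl fun d _ => by rw [tail_rot, h.rot]

variable (G)

/-- The conditions on a function on the darts to be the edge vectors of a rhombic embedding. -/
structure IsRhombic (e : D → ℂ) : Prop extends G.IsParallelogramCocycle e where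
  norm : ∀ d, ‖e d‖ = 1
  pos : ∀ d, 0 < (e (G.rot d) / e d).im

/-- Four times the signed area. -/
noncomputable def totalArea (e : D → ℂ) : ℝ := ∑ d, (star (e d) * e (G.next d)).im

variable {G}

theorem RhombicEmbedding.isRhombic (R : RhombicEmbedding G) : G.IsRhombic R.edge :=
  ⟨⟨R.edge_rev, R.face_closed⟩, R.norm_edge, R.face_pos⟩

theorem div_eq_star_mul {z w : ℂ} (hw : ‖w‖ = 1) : z / w = star w * z := by
  rw [div_eq_mul_inv, mul_comm, Complex.inv_def, Complex.normSq_eq_norm_sq, hw]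
  simp

theorem IsRhombic.star_mul_pos {e : D → ℂ} (h : G.IsRhombic e) (d : D) :
    0 < (star (e d) * e (G.next d)).im := by
  have := h.pos d
  rwa [div_eq_star_mul (h.norm d), h.rot] at this

theorem IsRhombic.totalArea_pos {e : D → ℂ} (h : G.IsRhombic e) : 0 < G.totalArea e := by
  have := G.nonempty
  exact Finset.sum_pos (fun d _ => h.star_mul_pos d) Finset.univ_nonempty

/-- Antisymmetry and conjugation together make the pairing purely imaginary; its imaginary part is
the area up to sign. -/
theorem pair_star_self {e : D → ℂ} (h : G.IsParallelogramCocycle e) :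
    G.pair e (star e) = -Complex.I * G.totalArea e := by
  have h1 : G.pair (star e) e = -G.pair e (star e) := pair_antisymm h.star
  have h2 : star (G.pair (star e) e) = G.pair e (star e) := by
    rw [← pair_star, star_star]
  have h3 : (G.pair (star e) e).im = G.totalArea e := by
    simp [pair, totalArea]
  rw [h1] at h2 h3
  apply Complex.ext
  · have := congrArg Complex.re h2
    simp at this ⊢
    linarith
  · simp at h3 ⊢
    linarith

/-- The area is a pairing of classes, and conjugation sends the coefficients `(a, b)` to `(star b,
star a)`. Hence the factor is the determinant of `z ↦ a * z + b * star z`. -/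
theorem totalArea_combination {e c : D → ℂ} (he : G.IsParallelogramCocycle e)
    (hc : G.IsParallelogramCocycle c) {a b : ℂ} {g : G.Vertex → ℂ}
    (h : c = a • e + b • star e + G.coboundary g) :
    G.totalArea c = (Complex.normSq a - Complex.normSq b) * G.totalArea e := by
  have hg : G.IsParallelogramCocycle (G.coboundary g) := by
    have : G.coboundary g = c + -(a • e + b • star e) := by rw [h]; abel
    rw [this]
    exact hc.add ((he.smul a).add (he.star.smul b)).neg
  have hs : star c = star b • e + star a • star e + star (G.coboundary g) := by
    rw [h]; ext d; simp; ring
  have key : G.pair c (star c)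
      = (Complex.normSq a - Complex.normSq b : ℝ) * G.pair e (star e) := by
    have h1 : G.pair c (star c) = G.pair (a • e + b • star e) (star c) := by
      conv_lhs => rw [h]
      rw [pair_add_left, ← h, pair_coboundary hc.star, add_zero]
    have h2 : G.pair c (star c) =
        G.pair (a • e + b • star e) (star b • e + star a • star e) := by
      rw [h1, hs, pair_add_right, pair_antisymm (c' := star (G.coboundary g))
        ((he.smul a).add (he.star.smul b))]
      have : G.pair (star (G.coboundary g)) (a • e + b • star e) = 0 := by
        have h3 := pair_coboundary ((he.smul a).add (he.star.smul b)).star g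
        rw [← star_star (a • e + b • star e), pair_star, h3, star_zero]
      rw [this]; ring
    rw [h2]
    simp only [pair_add_left, pair_add_right, pair_smul_left, pair_smul_right, pair_self he,
      pair_self he.star, pair_antisymm (c' := e) he.star]
    push_cast [Complex.normSq_eq_conj_mul_self]
    simp only [Complex.star_def]
    ring
  rw [pair_star_self hc, pair_star_self he] at key
  have := congrArg Complex.im key
  simp at this
  linarith

end TorusQuadrangulation

namespace TorusQuadrangulation

variable {D : Type*} [Fintype D] {G : TorusQuadrangulation D}

/-! ### The first cohomology of the torus is two-dimensional -/

section Cohomology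

theorem eq_or_eq_rev_of_sameCycle {d d' : D} (h : G.rev.SameCycle d d') :
    d' = d ∨ d' = G.rev d := by
  obtain ⟨n, -, hn⟩ := h.exists_pow_eq'
  have key : ∀ n : ℕ, (G.rev ^ n) d = d ∨ (G.rev ^ n) d = G.rev d := by
    intro n
    induction n with
    | zero => simp
    | succ k ih =>
      rw [pow_succ', Equiv.Perm.mul_apply]
      rcases ih with ih | ih <;> rw [ih]
      · exact Or.inr rfl
      · exact Or.inl (G.rev_rev d)
  rw [← hn]
  exact key n

theorem card_le_two_mul_card_edges :
    Nat.card D ≤ 2 * Nat.card (Quotient (Equiv.Perm.SameCycle.setoid G.rev)) := by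
  classical
  let f : D → Quotient (Equiv.Perm.SameCycle.setoid G.rev) × Bool := fun d =>
    (Quotient.mk (Equiv.Perm.SameCycle.setoid G.rev) d,
      decide ((Quotient.mk (Equiv.Perm.SameCycle.setoid G.rev) d).out = d))
  have hf : Function.Injective f := by
    intro d d' h
    have h1 : Quotient.mk (Equiv.Perm.SameCycle.setoid G.rev) d = Quotient.mk _ d' :=
      congrArg Prod.fst h
    have h2 := congrArg Prod.snd h
    simp only [f, ← h1, decide_eq_decide] at h2
    have a1 : G.rev.SameCycle (Quotient.mk (Equiv.Perm.SameCycle.setoid G.rev) d).out d :=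
      Quotient.exact (Quotient.out_eq (Quotient.mk (Equiv.Perm.SameCycle.setoid G.rev) d))
    have a2 : G.rev.SameCycle d d' := Quotient.exact h1
    rcases eq_or_eq_rev_of_sameCycle a1 with a | a
    · exact a.trans (h2.1 a.symm)
    · rcases eq_or_eq_rev_of_sameCycle (a1.trans a2) with b | b
      · exact (h2.2 b.symm).symm.trans b.symm
      · rw [a, b]
  have := Nat.card_le_card_of_injective f hf
  rw [Nat.card_prod, Nat.card_eq_fintype_card (α := Bool), Fintype.card_bool] at this
  omega

open Module in
/-- The space of cellular cocycles on a torus has dimension at most the number of vertices plus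
one. -/
theorem finrank_cocycles_le (Z : Submodule ℂ (D → ℂ))
    (hrev : ∀ c ∈ Z, ∀ d, c (G.rev d) = -c d)
    (hface : ∀ c ∈ Z, ∀ d, c d + c (G.next d) + c (G.next (G.next d))
      + c (G.next (G.next (G.next d))) = 0) :
    finrank ℂ Z ≤ Nat.card G.Vertex + 1 := by
  classical
  let QE := Quotient (Equiv.Perm.SameCycle.setoid G.rev)
  let QF := Quotient (Equiv.Perm.SameCycle.setoid G.next)
  let Ψ : ((QE → ℂ) × (QF → ℂ)) →ₗ[ℂ] (D → ℂ) :=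
    (LinearMap.funLeft ℂ ℂ (fun d => (Quotient.mk _ d : QE))).coprod
      (LinearMap.funLeft ℂ ℂ (fun d => (Quotient.mk _ d : QF)))
  have hΨ : ∀ x d, Ψ x d = x.1 (Quotient.mk _ d) + x.2 (Quotient.mk _ d) := fun x d => rfl
  have qE : ∀ d, (Quotient.mk _ (G.rev d) : QE) = Quotient.mk _ d := fun d =>
    Quotient.sound (Equiv.Perm.sameCycle_apply_left.2 (Equiv.Perm.SameCycle.refl G.rev d))
  have qF : ∀ d, (Quotient.mk _ (G.next d) : QF) = Quotient.mk _ d := fun d =>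
    Quotient.sound (Equiv.Perm.sameCycle_apply_left.2 (Equiv.Perm.SameCycle.refl G.next d))
  have hker : finrank ℂ (LinearMap.ker Ψ) ≤ 1 := by
    refine finrank_le_one ⟨((fun _ => 1), (fun _ => -1)), ?_⟩ ?_
    · rw [LinearMap.mem_ker]; ext d; simp [hΨ]
    · rintro ⟨⟨a, b⟩, hab⟩
      rw [LinearMap.mem_ker] at hab
      have hab' : ∀ d, a (Quotient.mk _ d) = - b (Quotient.mk _ d) := fun d =>
        eq_neg_of_add_eq_zero_left (congrFun hab d)
      have hc := G.eq_const (f := fun d => a (Quotient.mk _ d)) (fun d => by rw [qE])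
        (fun d => by rw [hab', hab', qF])
      obtain ⟨d₀⟩ := G.nonempty
      refine ⟨a (Quotient.mk _ d₀), ?_⟩
      ext q
      · induction q using Quotient.inductionOn with | h d => ?_
        simpa using hc d₀ d
      · induction q using Quotient.inductionOn with | h d => ?_
        have := hc d₀ d
        rw [hab' d] at this
        simp [this]
  -- A function of the edge sums to zero against an odd function, and a function of the face sums to
  -- zero against one with vanishing face sums. So the range of `Ψ` is orthogonal to `Z`.
  have hdisj : Disjoint (LinearMap.range Ψ) Z := by
    rw [Submodule.disjoint_def]
    rintro _ ⟨x, rfl⟩ hx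
    have horth : ∀ y : (QE → ℂ) × (QF → ℂ), ∑ d, Ψ y d * Ψ x d = 0 := by
      intro y
      have h1 : ∑ d, y.1 (Quotient.mk _ d) * Ψ x d = 0 := by
        have : ∑ d, y.1 (Quotient.mk _ d) * Ψ x d = -∑ d, y.1 (Quotient.mk _ d) * Ψ x d := by
          conv_lhs => rw [← Equiv.sum_comp G.rev]
          rw [← Finset.sum_neg_distrib]
          refine Finset.sum_congr rfl fun d _ => ?_
          rw [qE, hrev _ hx]; ring
        exact self_eq_neg.1 this
      have h2 : ∑ d, y.2 (Quotient.mk _ d) * Ψ x d = 0 := by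
        have step : ∀ f : D → ℂ, ∑ d, y.2 (Quotient.mk _ d) * f (G.next d)
            = ∑ d, y.2 (Quotient.mk _ d) * f d := by
          intro f
          conv_rhs => rw [← Equiv.sum_comp G.next]
          simp only [qF]
        have : ∑ d, y.2 (Quotient.mk _ d) * (Ψ x d + Ψ x (G.next d) + Ψ x (G.next (G.next d))
            + Ψ x (G.next (G.next (G.next d)))) = 0 :=
          Finset.sum_eq_zero fun d _ => by rw [hface _ hx, mul_zero]
        simp only [mul_add, Finset.sum_add_distrib] at this
        rw [step (fun d => Ψ x (G.next (G.next d))), step (fun d => Ψ x (G.next d)),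
          step (fun d => Ψ x d)] at this
        linear_combination this / 4
      simp only [hΨ y, add_mul, Finset.sum_add_distrib, h1, h2, add_zero]
    -- The orthogonality is bilinear; conjugating one argument, which stays in the range, turns it
    -- into a sum of squared norms.
    have h0 := horth (star x)
    have h1 : ∀ d, Ψ (star x) d * Ψ x d = (Complex.normSq (Ψ x d) : ℂ) := by
      intro d
      rw [Complex.normSq_eq_conj_mul_self, hΨ, hΨ]
      simp
    simp only [h1, ← Complex.ofReal_sum, Complex.ofReal_eq_zero] at h0
    ext d
    have := (Finset.sum_eq_zero_iff_of_nonneg (fun d _ => Complex.normSq_nonneg _)).1 h0 d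
      (Finset.mem_univ d)
    exact Complex.normSq_eq_zero.1 this
  have h1 := Submodule.finrank_add_finrank_le_of_disjoint hdisj
  have h2 := LinearMap.finrank_range_add_finrank_ker Ψ
  have : Fintype QE := Fintype.ofFinite _
  have : Fintype QF := Fintype.ofFinite _
  rw [finrank_prod, finrank_fintype_fun_eq_card, finrank_fintype_fun_eq_card,
    ← Nat.card_eq_fintype_card, ← Nat.card_eq_fintype_card] at h2
  rw [finrank_fintype_fun_eq_card, ← Nat.card_eq_fintype_card] at h1
  -- With `V`, `E`, `F` vertices, edges and faces, the range has dimension at least `E + F - 1`, so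
  -- `Z` has dimension at most `2E - (E + F - 1) = V + 1` by Euler's formula.
  have h3 := card_le_two_mul_card_edges (G := G)
  have h4 := G.euler
  change Nat.card G.Vertex + Nat.card QF = Nat.card QE at h4
  change Nat.card D ≤ 2 * Nat.card QE at h3
  omega

instance : Finite G.Vertex := inferInstanceAs (Finite (Quotient _))

/-- On a torus, every parallelogram cocycle is, up to a coboundary, a combination of a rhombic
cocycle and its conjugate. -/
theorem IsRhombic.exists_combination {e c : D → ℂ} (he : G.IsRhombic e)
    (hc : G.IsParallelogramCocycle c) :
    ∃ (a b : ℂ) (g : G.Vertex → ℂ), c = a • e + b • star e + G.coboundary g := by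
  classical
  let Z : Submodule ℂ (D → ℂ) :=
    { carrier := {c | (∀ d, c (G.rev d) = -c d) ∧ ∀ d, c d + c (G.next d)
        + c (G.next (G.next d)) + c (G.next (G.next (G.next d))) = 0}
      add_mem' := fun {x y} hx hy => ⟨fun d => by simp [hx.1, hy.1]; ring, fun d => by
        simp only [Pi.add_apply]; linear_combination hx.2 d + hy.2 d⟩
      zero_mem' := ⟨fun d => by simp, fun d => by simp⟩
      smul_mem' := fun a x hx => ⟨fun d => by simp [hx.1], fun d => by
        simp only [Pi.smul_apply, smul_eq_mul]; linear_combination a * hx.2 d⟩ }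
  have hP : ∀ c, G.IsParallelogramCocycle c → c ∈ Z := fun c hc =>
    ⟨hc.rev, fun d => by rw [hc.opp, hc.opp]; ring⟩
  let Φ : ((ℂ × ℂ) × (G.Vertex → ℂ)) →ₗ[ℂ] (D → ℂ) :=
    { toFun := fun x => x.1.1 • e + x.1.2 • star e + G.coboundary x.2
      map_add' := fun x y => by ext d; simp [coboundary]; ring
      map_smul' := fun a x => by ext d; simp [coboundary]; ring }
  have hΦ : ∀ x, Φ x = x.1.1 • e + x.1.2 • star e + G.coboundary x.2 := fun x => rfl
  have hB : ∀ g, G.coboundary g ∈ Z := fun g => ⟨fun d => by simp [coboundary, G.rev_rev], fun d => by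
    simp only [coboundary, ← tail_next, next_pow_four]; ring⟩
  have hle : LinearMap.range Φ ≤ Z := by
    rintro _ ⟨x, rfl⟩
    rw [hΦ]
    exact Z.add_mem (Z.add_mem (Z.smul_mem _ (hP _ he.1)) (Z.smul_mem _ (hP _ he.1.star)))
      (hB _)
  have hne : G.pair e (star e) ≠ 0 := by
    rw [pair_star_self he.1]
    simpa using he.totalArea_pos.ne'
  -- Pairing a relation with `e` and `star e` kills `b` and `a`; what remains is a function with
  -- zero coboundary, a constant.
  have hker : Module.finrank ℂ (LinearMap.ker Φ) ≤ 1 := by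
    refine finrank_le_one ⟨((0, 0), (fun _ => 1)), ?_⟩ ?_
    · rw [LinearMap.mem_ker]; ext d; simp [hΦ, coboundary]
    · rintro ⟨⟨⟨a, b⟩, g⟩, hx⟩
      rw [LinearMap.mem_ker, hΦ] at hx
      have hb : b = 0 := by
        have := congrArg (fun f => G.pair f e) hx
        simp only [pair_add_left, pair_smul_left, pair_self he.1, pair_coboundary he.1,
          pair_antisymm (c' := e) he.1.star] at this
        have h0 : G.pair 0 e = 0 := by simp [pair]
        rw [h0] at this
        simpa [hne] using this
      have ha : a = 0 := by
        have := congrArg (fun f => G.pair f (star e)) hx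
        simp only [pair_add_left, pair_smul_left, pair_self he.1.star,
          pair_coboundary he.1.star] at this
        have h0 : G.pair 0 (star e) = 0 := by simp [pair]
        rw [h0] at this
        simpa [hne] using this
      subst ha hb
      have hg : ∀ d, g (G.tail (G.rev d)) = g (G.tail d) := fun d => by
        have := congrFun hx d
        simpa [coboundary, sub_eq_zero] using this
      obtain ⟨d₀⟩ := G.nonempty
      have hc := G.eq_const (f := fun d => g (G.tail d)) hg (fun d => by rw [tail_next, hg])
      refine ⟨g (G.tail d₀), ?_⟩
      ext v
      · simp
      · simp
      · induction v using Quotient.inductionOn with | h d => ?_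
        exact (mul_one _).trans (hc d₀ d)
  have hZ := finrank_cocycles_le (G := G) Z (fun c hc => hc.1) (fun c hc => hc.2)
  have h2 := LinearMap.finrank_range_add_finrank_ker Φ
  have : Fintype G.Vertex := Fintype.ofFinite _
  rw [Module.finrank_prod, Module.finrank_prod, Module.finrank_fintype_fun_eq_card,
    ← Nat.card_eq_fintype_card, Module.finrank_self] at h2
  -- The range of `Φ` has dimension at least `2 + V - 1`, which is the upper bound for `Z`.
  have heq := Submodule.eq_of_le_of_finrank_le hle (by omega)
  have := hP c hc
  rw [← heq] at this
  obtain ⟨x, hx⟩ := this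
  exact ⟨_, _, _, hx.symm⟩

end Cohomology

/-! ### Asymptotic vectors and intersections of tracks -/

section Tracks

open Classical in
/-- The displacement along one period of a train track: the sum over the faces of the track of
the edge parallel to the direction of travel. -/
noncomputable def trackSum (c : D → ℂ) (t : G.OrientedTrainTrack) : ℂ :=
  ∑ d : D with G.track d = t, c (G.next d)

open Classical in
/-- The cocycle dual to a train track. -/
noncomputable def trackCocycle (t : G.OrientedTrainTrack) (d : D) : ℂ :=
  (if G.track d = t then 1 else 0) - (if G.track (G.rev d) = t then 1 else 0)

theorem isParallelogramCocycle_trackCocycle (t : G.OrientedTrainTrack) :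
    G.IsParallelogramCocycle (trackCocycle t) := by
  classical
  refine ⟨fun d => ?_, fun d => ?_⟩
  · simp [trackCocycle, G.rev_rev]
  · rw [next_next_eq]
    simp [trackCocycle, G.rev_rev, track_cross, G.track_rev_congr (track_cross G d)]

/-- Every face on the track is seen from its entrance and from its exit, with equal contributions;
hence the factor two. It makes `trackSum` cohomological. -/
theorem pair_trackCocycle {c : D → ℂ} (hc : G.IsParallelogramCocycle c)
    (t : G.OrientedTrainTrack) : G.pair (trackCocycle t) c = 2 * trackSum c t := by
  classical
  have h1 : G.pair (trackCocycle t) c = trackSum c t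
      - ∑ d, (if G.track (G.rev d) = t then 1 else 0) * c (G.next d) := by
    simp [pair, trackCocycle, sub_mul, trackSum, Finset.sum_filter]
  have h2 : ∑ d, (if G.track (G.rev d) = t then 1 else 0) * c (G.next d) = -trackSum c t := by
    rw [← Equiv.sum_comp (G.next * G.next)]
    simp only [Equiv.Perm.mul_apply, ← cross_apply, track_cross, hc.opp]
    simp [trackSum, Finset.sum_filter, ← Finset.sum_neg_distrib, apply_ite]
  rw [h1, h2]; ring

theorem trackSum_combination {e c : D → ℂ} (he : G.IsParallelogramCocycle e)
    (hc : G.IsParallelogramCocycle c) {a b : ℂ} {g : G.Vertex → ℂ}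
    (h : c = a • e + b • star e + G.coboundary g) (t : G.OrientedTrainTrack) :
    trackSum c t = a * trackSum e t + b * star (trackSum e t) := by
  have hs : trackSum (star e) t = star (trackSum e t) := by simp [trackSum]
  have hχ := isParallelogramCocycle_trackCocycle t
  have h0 : G.pair (trackCocycle t) (G.coboundary g) = 0 := by
    rw [pair_antisymm hχ, pair_coboundary hχ, neg_zero]
  have h1 := pair_trackCocycle hc t
  rw [← hs]
  rw [h, pair_add_right, pair_add_right, h0, pair_smul_right, pair_smul_right,
    pair_trackCocycle he, pair_trackCocycle he.star, ← h] at h1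
  linear_combination -h1 / 2

theorem trackSum_rev {c : D → ℂ} (hc : G.IsParallelogramCocycle c) (d : D) :
    trackSum c (G.track (G.rev d)) = -trackSum c (G.track d) := by
  have h : trackCocycle (G.track (G.rev d)) = -(trackCocycle (G.track d)) := by
    classical
    ext x
    have : G.track x = G.track (G.rev d) ↔ G.track (G.rev x) = G.track d :=
      ⟨fun h => by simpa [G.rev_rev] using G.track_rev_congr h,
       fun h => by simpa [G.rev_rev] using G.track_rev_congr h⟩
    have h' : G.track (G.rev x) = G.track (G.rev d) ↔ G.track x = G.track d :=
      ⟨fun h => by simpa [G.rev_rev] using G.track_rev_congr h, G.track_rev_congr⟩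
    simp [trackCocycle, this, h']
  have h1 := pair_trackCocycle hc (G.track (G.rev d))
  rw [h] at h1
  have h2 : G.pair (-trackCocycle (G.track d)) c = -G.pair (trackCocycle (G.track d)) c := by
    simp [pair]
  rw [h2, pair_trackCocycle hc] at h1
  linear_combination -h1 / 2

/-- The intersection number of two tracks, in terms of their asymptotic vectors. -/
theorem IsRhombic.pair_trackCocycle_mul {e : D → ℂ} (he : G.IsRhombic e)
    (t t' : G.OrientedTrainTrack) :
    G.pair (trackCocycle t) (trackCocycle t') * G.totalArea e
      = 8 * (star (trackSum e t) * trackSum e t').im := by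
  have hs : ∀ t : G.OrientedTrainTrack, trackSum (star e) t = star (trackSum e t) := fun t => by simp [trackSum]
  have hχ := isParallelogramCocycle_trackCocycle t
  have hχ' := isParallelogramCocycle_trackCocycle t'
  -- The coefficients of the two dual classes are read off from their pairings with `e` and `star
  -- e`, which are the asymptotic vectors. In the factor `8`, the pairing is twice the signed number
  -- of crossings and `totalArea` is four times the area.
  obtain ⟨a, b, g, h⟩ := he.exists_combination hχ
  obtain ⟨a', b', g', h'⟩ := he.exists_combination hχ'
  have ev : ∀ c, G.IsParallelogramCocycle c → G.pair (trackCocycle t) c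
      = a * G.pair e c + b * G.pair (star e) c := fun c hc => by
    rw [h, pair_add_left, pair_add_left, pair_coboundary hc, pair_smul_left, pair_smul_left,
      add_zero]
  have ev' : ∀ c, G.IsParallelogramCocycle c → G.pair (trackCocycle t') c
      = a' * G.pair e c + b' * G.pair (star e) c := fun c hc => by
    rw [h', pair_add_left, pair_add_left, pair_coboundary hc, pair_smul_left, pair_smul_left,
      add_zero]
  have hΩ := pair_star_self he.1
  have hΩ' : G.pair (star e) e = Complex.I * G.totalArea e := by
    rw [pair_antisymm he.1.star, hΩ]; ring
  have e1 := pair_trackCocycle he.1 t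
  have e2 := pair_trackCocycle he.1.star t
  have e1' := pair_trackCocycle he.1 t'
  have e2' := pair_trackCocycle he.1.star t'
  rw [hs] at e2 e2'
  have key := ev _ hχ'
  rw [pair_antisymm he.1, pair_antisymm he.1.star, ev' _ he.1, ev' _ he.1.star] at key
  rw [ev _ he.1] at e1
  rw [ev _ he.1.star] at e2
  rw [ev' _ he.1] at e1'
  rw [ev' _ he.1.star] at e2'
  rw [pair_self he.1, pair_self he.1.star, hΩ, hΩ'] at *
  have him : ((star (trackSum e t) * trackSum e t').im : ℂ)
      = (star (trackSum e t) * trackSum e t' - trackSum e t * star (trackSum e t'))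
        / (2 * Complex.I) := by
    rw [Complex.im_eq_sub_conj]
    simp
  rw [him, key]
  have t1 : trackSum e t = (b * (Complex.I * G.totalArea e)) / 2 := by linear_combination -e1 / 2
  have t2 : star (trackSum e t) = (a * (-Complex.I * G.totalArea e)) / 2 := by
    linear_combination -e2 / 2
  have t1' : trackSum e t' = (b' * (Complex.I * G.totalArea e)) / 2 := by
    linear_combination -e1' / 2
  have t2' : star (trackSum e t') = (a' * (-Complex.I * G.totalArea e)) / 2 := by
    linear_combination -e2' / 2
  rw [t2, t2', t1, t1']
  field_simp
  ring

/-- The asymptotic vectors of crossing tracks are positively oriented. -/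
theorem IsRhombic.trackSum_cross_pos {e : D → ℂ} (he : G.IsRhombic e) (d : D) :
    0 < (star (trackSum e (G.track d)) * trackSum e (G.track (G.next d))).im := by
  classical
  have h := he.pair_trackCocycle_mul (G.track d) (G.track (G.next d))
  rw [pair_trackCocycle (isParallelogramCocycle_trackCocycle _)] at h
  have hpos : 0 < (trackSum (trackCocycle (G.track (G.next d))) (G.track d)).re := by
    -- Two tracks cross with only one sign: the edges are constant along tracks, so an opposite
    -- crossing would reverse the orientation of a face.
    have hnot : ∀ x, G.track x = G.track d → G.track (G.rev (G.next x)) ≠ G.track (G.next d) := by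
      intro x hx hx'
      have h1 := he.1.track_congr hx
      have h2 := he.1.track_congr hx'
      rw [he.rev] at h2
      have p1 := he.star_mul_pos x
      have p2 := he.star_mul_pos d
      rw [← h2, ← h1] at p2
      simp at p1 p2
      linarith
    rw [trackSum, Complex.re_sum]
    refine Finset.sum_pos' (fun x hx => ?_) ⟨d, by simp, ?_⟩
    · have := hnot x (by simpa using hx)
      rw [trackCocycle, if_neg this]
      split_ifs <;> simp
    · rw [trackCocycle, if_neg (hnot d rfl)]
      simp
  have hre := congrArg Complex.re h
  have hS := he.totalArea_pos
  rw [Complex.re_mul_ofReal, ← Complex.ofReal_ofNat, Complex.re_ofReal_mul,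
    ← Complex.ofReal_ofNat, Complex.re_ofReal_mul, Complex.ofReal_re] at hre
  have := mul_pos (mul_pos two_pos hpos) hS
  linarith

theorem IsRhombic.trackSum_pos {e : D → ℂ} (he : G.IsRhombic e) (d : D) :
    0 < (star (e d) * trackSum e (G.track d)).im := by
  classical
  rw [trackSum, Finset.mul_sum, Complex.im_sum]
  refine Finset.sum_pos (fun x hx => ?_) ⟨d, by simp⟩
  rw [← he.1.track_congr (Finset.mem_filter.1 hx).2]
  exact he.star_mul_pos x

theorem RhombicEmbedding.asymptoticVector_eq (R : RhombicEmbedding G)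
    (t : G.OrientedTrainTrack) : R.asymptoticVector t = trackSum R.edge t := by
  rw [asymptoticVector, trackSum]
  refine Finset.sum_congr rfl fun d _ => ?_
  rw [R.face_closed]; ring

end Tracks

end TorusQuadrangulation

namespace TorusQuadrangulation

variable {D : Type*} [Fintype D] {G : TorusQuadrangulation D}

/-! ### Interpolation of angles and concavity of the area -/

section Angles

theorem arg_mem_Ioo_of_im_pos {z : ℂ} (hz : 0 < z.im) : z.arg ∈ Set.Ioo 0 Real.pi := by
  refine ⟨lt_of_le_of_ne (Complex.arg_nonneg_iff.2 hz.le) fun h => ?_, ?_⟩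
  · exact hz.ne' (Complex.arg_eq_zero_iff.1 h.symm).2
  · exact Complex.arg_lt_pi_iff.2 (Or.inr hz.ne')

theorem eq_of_coe_angle_eq {x y : ℝ} (h : (x : Real.Angle) = y) (h1 : x - y < 2 * Real.pi)
    (h2 : -(2 * Real.pi) < x - y) : x = y := by
  obtain ⟨k, hk⟩ := Real.Angle.angle_eq_iff_two_pi_dvd_sub.1 h
  have hp := Real.pi_pos
  rw [hk] at h1 h2
  have k1 : (k : ℝ) < 1 := by nlinarith
  have k2 : (-1 : ℝ) < k := by nlinarith
  have k0 : k = 0 := by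
    have : k < 1 := by exact_mod_cast k1
    have : -1 < k := by exact_mod_cast k2
    omega
  rw [k0] at hk
  simp at hk
  linarith

theorem div_im_pos_iff {z w : ℂ} (hw : w ≠ 0) : 0 < (z / w).im ↔ 0 < (star w * z).im := by
  have h : (z / w).im = (Complex.normSq w)⁻¹ * (star w * z).im := by
    rw [div_eq_mul_inv, mul_comm, Complex.inv_def, mul_right_comm, mul_comm,
      Complex.im_ofReal_mul]
    simp
  rw [h]
  exact mul_pos_iff_of_pos_left (inv_pos.2 (Complex.normSq_pos.2 hw))

theorem IsRhombic.ne_zero {e : D → ℂ} (he : G.IsRhombic e) (d : D) : e d ≠ 0 := by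
  intro h
  have := he.norm d
  simp [h] at this

theorem IsRhombic.trackSum_ne_zero {e : D → ℂ} (he : G.IsRhombic e) (d : D) :
    trackSum e (G.track d) ≠ 0 := by
  intro h
  have := he.trackSum_pos d
  simp [h] at this

/-- The angle between consecutive transversals, computed from the asymptotic directions. -/
theorem IsRhombic.arg_trackSum {e : D → ℂ} (he : G.IsRhombic e) (d : D) :
    (trackSum e (G.track (G.next d)) / e (G.next d)).arg - (trackSum e (G.track d) / e d).arg
      + (e (G.next d) / e d).arg
      = (trackSum e (G.track (G.next d)) / trackSum e (G.track d)).arg := by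
  have p1 := arg_mem_Ioo_of_im_pos ((div_im_pos_iff (he.ne_zero _)).2 (he.trackSum_pos d))
  have p2 := arg_mem_Ioo_of_im_pos ((div_im_pos_iff (he.ne_zero _)).2
    (he.trackSum_pos (G.next d)))
  have p3 := arg_mem_Ioo_of_im_pos ((div_im_pos_iff (he.ne_zero _)).2 (he.star_mul_pos d))
  have p4 := arg_mem_Ioo_of_im_pos ((div_im_pos_iff (he.trackSum_ne_zero _)).2
    (he.trackSum_cross_pos d))
  -- All four arguments lie in `(0, π)`, so the two sides differ by less than `2π` and agreement
  -- modulo `2π` suffices.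
  refine eq_of_coe_angle_eq ?_ (by linarith [p1.1, p1.2, p2.1, p2.2, p3.1, p3.2, p4.1, p4.2])
    (by linarith [p1.1, p1.2, p2.1, p2.2, p3.1, p3.2, p4.1, p4.2])
  rw [Real.Angle.coe_add, Real.Angle.coe_sub,
    Complex.arg_div_coe_angle (he.trackSum_ne_zero _) (he.ne_zero _),
    Complex.arg_div_coe_angle (he.trackSum_ne_zero _) (he.ne_zero _),
    Complex.arg_div_coe_angle (he.ne_zero _) (he.ne_zero _),
    Complex.arg_div_coe_angle (he.trackSum_ne_zero _) (he.trackSum_ne_zero _)]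
  abel

/-- The difference of the angle functions of two rhombic cocycles comes from a real function on
the tracks. -/
theorem IsRhombic.exists_angle_difference {e₀ e₁ : D → ℂ} (h₀ : G.IsRhombic e₀)
    (h₁ : G.IsRhombic e₁) :
    ∃ β : D → ℝ, (∀ d, β (G.rev d) = β d) ∧ (∀ d, β (G.cross d) = β d) ∧
      ∀ d, β (G.next d) - β d = (e₁ (G.next d) / e₁ d).arg - (e₀ (G.next d) / e₀ d).arg := by
  obtain ⟨a, b, g, h⟩ := h₀.exists_combination h₁.1
  have hdet : Complex.normSq b < Complex.normSq a := by
    have := totalArea_combination h₀.1 h₁.1 h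
    have p0 := h₀.totalArea_pos
    have p1 := h₁.totalArea_pos
    rw [this] at p1
    linarith [(mul_pos_iff_of_pos_right p0).1 p1]
  have ha : a ≠ 0 := by
    rintro rfl
    simp at hdet
    exact absurd hdet (not_lt.2 (Complex.normSq_nonneg b))
  set w₀ : D → ℂ := fun d => trackSum e₀ (G.track d) with hw₀
  set w₁ : D → ℂ := fun d => trackSum e₁ (G.track d) with hw₁
  have n0 : ∀ d, w₀ d ≠ 0 := h₀.trackSum_ne_zero
  have n1 : ∀ d, w₁ d ≠ 0 := h₁.trackSum_ne_zero
  have hw : ∀ d, w₁ d = a * w₀ d + b * star (w₀ d) := fun d =>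
    trackSum_combination h₀.1 h₁.1 h _
  -- The quotient is `1 + b * star (w₀ d) / (a * w₀ d)`, whose second term has norm `|b| / |a| < 1`.
  have hε : ∀ d, |(w₁ d / (a * w₀ d)).arg| < Real.pi / 2 := by
    intro d
    refine Complex.abs_arg_lt_pi_div_two_iff.2 (Or.inl ?_)
    have h1 : w₁ d / (a * w₀ d) = 1 + b * star (w₀ d) / (a * w₀ d) := by
      rw [hw, add_div, div_self (mul_ne_zero ha (n0 d))]
    have h2 : ‖b * star (w₀ d) / (a * w₀ d)‖ < 1 := by
      rw [norm_div, norm_mul, norm_mul, norm_star, mul_div_mul_right _ _ (norm_ne_zero_iff.2 (n0 d)),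
        div_lt_one (norm_pos_iff.2 ha)]
      rw [Complex.normSq_eq_norm_sq, Complex.normSq_eq_norm_sq] at hdet
      exact lt_of_pow_lt_pow_left₀ 2 (norm_nonneg _) hdet
    have h3 := Complex.abs_re_le_norm (b * star (w₀ d) / (a * w₀ d))
    rw [h1, Complex.add_re, Complex.one_re]
    linarith [(abs_le.1 h3).1]
  -- Modulo `2π` this is the argument of `e₁ d / (a * e₀ d)`. Passing through the asymptotic vectors
  -- selects a real lift for which neighbouring differences are exact.
  refine ⟨fun d => (w₁ d / (a * w₀ d)).arg - (w₁ d / e₁ d).arg + (w₀ d / e₀ d).arg, ?_, ?_, ?_⟩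
  · intro d
    have r0 : w₀ (G.rev d) = -w₀ d := trackSum_rev h₀.1 d
    have r1 : w₁ (G.rev d) = -w₁ d := trackSum_rev h₁.1 d
    simp only [r0, r1, h₀.rev, h₁.rev, mul_neg, neg_div_neg_eq]
  · intro d
    simp only [hw₀, hw₁, track_cross, h₀.1.cross, h₁.1.cross]
  · intro d
    have t0 := h₀.arg_trackSum d
    have t1 := h₁.arg_trackSum d
    change (w₀ (G.next d) / e₀ (G.next d)).arg - (w₀ d / e₀ d).arg + (e₀ (G.next d) / e₀ d).arg
      = (w₀ (G.next d) / w₀ d).arg at t0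
    change (w₁ (G.next d) / e₁ (G.next d)).arg - (w₁ d / e₁ d).arg + (e₁ (G.next d) / e₁ d).arg
      = (w₁ (G.next d) / w₁ d).arg at t1
    have p0 := arg_mem_Ioo_of_im_pos ((div_im_pos_iff (n0 d)).2 (h₀.trackSum_cross_pos d))
    have p1 := arg_mem_Ioo_of_im_pos ((div_im_pos_iff (n1 d)).2 (h₁.trackSum_cross_pos d))
    change (w₀ (G.next d) / w₀ d).arg ∈ _ at p0
    change (w₁ (G.next d) / w₁ d).arg ∈ _ at p1
    have key : (w₁ (G.next d) / (a * w₀ (G.next d))).arg - (w₁ d / (a * w₀ d)).arg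
        = (w₁ (G.next d) / w₁ d).arg - (w₀ (G.next d) / w₀ d).arg := by
      have b1 := abs_lt.1 (hε d)
      have b2 := abs_lt.1 (hε (G.next d))
      refine eq_of_coe_angle_eq ?_ (by linarith [p0.1, p0.2, p1.1, p1.2])
        (by linarith [p0.1, p0.2, p1.1, p1.2])
      rw [Real.Angle.coe_sub, Real.Angle.coe_sub,
        Complex.arg_div_coe_angle (n1 _) (mul_ne_zero ha (n0 _)),
        Complex.arg_div_coe_angle (n1 _) (mul_ne_zero ha (n0 _)),
        Complex.arg_mul_coe_angle ha (n0 _), Complex.arg_mul_coe_angle ha (n0 _),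
        Complex.arg_div_coe_angle (n1 _) (n1 _), Complex.arg_div_coe_angle (n0 _) (n0 _)]
      abel
    simp only
    linarith

theorem IsRhombic.exp_arg {e : D → ℂ} (he : G.IsRhombic e) (d : D) :
    Complex.exp ((e (G.next d) / e d).arg * Complex.I) = e (G.next d) / e d := by
  have := Complex.norm_mul_exp_arg_mul_I (e (G.next d) / e d)
  rwa [norm_div, he.norm, he.norm, div_one, Complex.ofReal_one, one_mul] at this

/-- Linear interpolation of the angles of two rhombic cocycles. -/
theorem IsRhombic.exists_interpolation {e₀ e₁ : D → ℂ} (h₀ : G.IsRhombic e₀)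
    (h₁ : G.IsRhombic e₁) {r s : ℝ} (hr : 0 ≤ r) (hs : 0 ≤ s) (hrs : r + s = 1) :
    ∃ e, G.IsRhombic e ∧ ∀ d, (e (G.next d) / e d).arg
      = r * (e₀ (G.next d) / e₀ d).arg + s * (e₁ (G.next d) / e₁ d).arg := by
  obtain ⟨β, hrev, hcross, hβ⟩ := h₀.exists_angle_difference h₁
  let e : D → ℂ := fun d => e₀ d * Complex.exp ((s * β d : ℝ) * Complex.I)
  have hc : G.IsParallelogramCocycle e := by
    refine ⟨fun d => ?_, fun d => ?_⟩
    · simp only [e, h₀.rev, hrev, neg_mul]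
    · simp only [e, next_next_eq, hrev, hcross]
      rw [← next_next_eq, h₀.opp, neg_mul]
  have hratio : ∀ d, e (G.next d) / e d = Complex.exp (((r * (e₀ (G.next d) / e₀ d).arg
      + s * (e₁ (G.next d) / e₁ d).arg : ℝ) : ℂ) * Complex.I) := by
    intro d
    have h1 : e (G.next d) / e d = (e₀ (G.next d) / e₀ d) *
        (Complex.exp ((s * β (G.next d) : ℝ) * Complex.I)
          / Complex.exp ((s * β d : ℝ) * Complex.I)) := by
      simp only [e]; rw [mul_div_mul_comm]
    rw [h1, ← Complex.exp_sub, ← h₀.exp_arg, ← Complex.exp_add]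
    congr 1
    rw [h₀.exp_arg]
    have h2 : r * (e₀ (G.next d) / e₀ d).arg + s * (e₁ (G.next d) / e₁ d).arg
        = (e₀ (G.next d) / e₀ d).arg + (s * β (G.next d) - s * β d) := by
      have hr' : r = 1 - s := by linarith
      rw [hr']
      linear_combination -s * hβ d
    rw [h2]
    push_cast
    ring
  have hrange : ∀ d, r * (e₀ (G.next d) / e₀ d).arg + s * (e₁ (G.next d) / e₁ d).arg
      ∈ Set.Ioo 0 Real.pi := by
    intro d
    have p0 := arg_mem_Ioo_of_im_pos ((div_im_pos_iff (h₀.ne_zero _)).2 (h₀.star_mul_pos d))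
    have p1 := arg_mem_Ioo_of_im_pos ((div_im_pos_iff (h₁.ne_zero _)).2 (h₁.star_mul_pos d))
    exact (convex_Ioo (0 : ℝ) Real.pi) p0 p1 hr hs hrs
  refine ⟨e, ⟨hc, fun d => ?_, fun d => ?_⟩, fun d => ?_⟩
  · simp only [e]
    rw [norm_mul, Complex.norm_exp_ofReal_mul_I, h₀.norm, mul_one]
  · rw [hc.rot, hratio, Complex.exp_ofReal_mul_I_im]
    exact Real.sin_pos_of_mem_Ioo (hrange d)
  · rw [hratio, Complex.arg_exp_mul_I, toIocMod_eq_self Real.two_pi_pos]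
    have := hrange d
    exact ⟨by linarith [this.1, Real.pi_pos], by linarith [this.2]⟩

theorem IsRhombic.sin_arg {e : D → ℂ} (he : G.IsRhombic e) (d : D) :
    Real.sin (e (G.next d) / e d).arg = (star (e d) * e (G.next d)).im := by
  rw [Complex.sin_arg, norm_div, he.norm, he.norm, div_one, div_one, div_eq_star_mul (he.norm d)]

theorem IsRhombic.cos_arg {e : D → ℂ} (he : G.IsRhombic e) (d : D) :
    Real.cos (e (G.next d) / e d).arg = (star (e d) * e (G.next d)).re := by
  rw [Complex.cos_arg (div_ne_zero (he.ne_zero _) (he.ne_zero _)), norm_div, he.norm, he.norm,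
    div_one, div_one, div_eq_star_mul (he.norm d)]

theorem IsRhombic.totalArea_eq_sum_sin {e : D → ℂ} (he : G.IsRhombic e) :
    G.totalArea e = ∑ d, Real.sin (e (G.next d) / e d).arg := by
  simp only [totalArea, he.sin_arg]

theorem sin_le_tangent {x y : ℝ} (hx : x ∈ Set.Icc 0 Real.pi) (hy : y ∈ Set.Icc 0 Real.pi) :
    Real.sin y ≤ Real.sin x + Real.cos x * (y - x) := by
  have hc := strictConcaveOn_sin_Icc.concaveOn
  rcases lt_trichotomy x y with h | rfl | h
  · have := hc.slope_le_of_hasDerivAt hx hy h (Real.hasDerivAt_sin x)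
    rw [slope_def_field, div_le_iff₀ (by linarith)] at this
    linarith
  · simp
  · have := hc.le_slope_of_hasDerivAt hy hx h (Real.hasDerivAt_sin x)
    rw [slope_def_field, le_div_iff₀ (by linarith)] at this
    linarith

/-- A rhombic cocycle whose transversals are orthogonal to the asymptotic vectors maximizes the
area. -/
theorem IsRhombic.totalArea_le_of_orthogonal {e₀ e₁ : D → ℂ} (h₀ : G.IsRhombic e₀)
    (h₁ : G.IsRhombic e₁) (horth : ∀ d, (star (e₀ d) * trackSum e₀ (G.track d)).re = 0) :
    G.totalArea e₁ ≤ G.totalArea e₀ := by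
  classical
  obtain ⟨β, hrev, hcross, hβ⟩ := h₀.exists_angle_difference h₁
  set C : D → ℝ := fun d => (star (e₀ d) * e₀ (G.next d)).re with hC
  -- Both `β` and `e₀` are constant on a track, so each track contributes `β` times the real part
  -- that vanishes by orthogonality.
  have hCβ : ∑ d, C d * β d = 0 := by
    have : Finite G.OrientedTrainTrack := inferInstanceAs (Finite (Quotient _))
    have : Fintype G.OrientedTrainTrack := Fintype.ofFinite _
    rw [← Finset.sum_fiberwise (s := Finset.univ) (g := G.track)]
    refine Finset.sum_eq_zero fun t _ => ?_
    induction t using Quotient.inductionOn with | h d₀ => ?_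
    change ∑ d with G.track d = G.track d₀, C d * β d = 0
    have h1 : ∑ d with G.track d = G.track d₀, C d * β d
        = (∑ d with G.track d = G.track d₀, (star (e₀ d₀) * e₀ (G.next d))).re * β d₀ := by
      rw [Complex.re_sum, Finset.sum_mul]
      refine Finset.sum_congr rfl fun d hd => ?_
      have hd' := (Finset.mem_filter.1 hd).2
      rw [hC, G.eq_of_track_eq hcross hd']
      simp only
      rw [h₀.1.track_congr hd']
    rw [h1, ← Finset.mul_sum]
    have := horth d₀
    rw [trackSum] at this
    rw [this, zero_mul]
  -- Adjacent wedges of a rhombus have opposite cosines, so a shift by `next` reduces this sum to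
  -- the previous one.
  have hCn : ∑ d, C d * β (G.next d) = 0 := by
    rw [← Equiv.sum_comp G.next, ← neg_eq_zero, ← hCβ, ← Finset.sum_neg_distrib]
    refine Finset.sum_congr rfl fun d _ => ?_
    simp only [hC, h₀.opp]
    rw [next_next_eq, hrev, hcross]
    simp
    ring
  rw [h₀.totalArea_eq_sum_sin, h₁.totalArea_eq_sum_sin]
  have key : ∀ d, Real.sin (e₁ (G.next d) / e₁ d).arg ≤ Real.sin (e₀ (G.next d) / e₀ d).arg
      + (C d * β (G.next d) - C d * β d) := by
    intro d
    have p0 := arg_mem_Ioo_of_im_pos ((div_im_pos_iff (h₀.ne_zero _)).2 (h₀.star_mul_pos d))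
    have p1 := arg_mem_Ioo_of_im_pos ((div_im_pos_iff (h₁.ne_zero _)).2 (h₁.star_mul_pos d))
    have := sin_le_tangent ⟨p0.1.le, p0.2.le⟩ ⟨p1.1.le, p1.2.le⟩
    rw [← hβ, h₀.cos_arg] at this
    simp only [hC]
    linarith
  calc _ ≤ _ := Finset.sum_le_sum fun d _ => key d
    _ = _ := by rw [Finset.sum_add_distrib, Finset.sum_sub_distrib, hCn, hCβ]; ring

end Angles

/-! ### Variation of one track and existence of a maximizer -/

section Maximum

/-- First variation of the area: at a maximum among unit cocycles, each transversal is orthogonal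
to its track. -/
theorem star_mul_trackSum_of_isMax {e : D → ℂ} (he : G.IsParallelogramCocycle e)
    (hn : ∀ d, ‖e d‖ = 1)
    (hmax : ∀ c, G.IsParallelogramCocycle c → (∀ d, ‖c d‖ = 1) → G.totalArea c ≤ G.totalArea e)
    (d₀ : D) :
    star (e d₀) * trackSum e (G.track d₀) = Complex.I * ‖trackSum e (G.track d₀)‖ := by
  classical
  set t := G.track d₀ with ht
  set v := trackSum e t with hv
  rcases eq_or_ne v 0 with hv0 | hv0
  · simp [hv0]
  have hvn : (‖v‖ : ℂ) ≠ 0 := by simpa using hv0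
  -- The unit vector for which `star u * v` is positive imaginary, the best possible value for this
  -- track. The competitor replaces `e d₀` by `u` on the whole track and leaves the other tracks
  -- unchanged.
  set u : ℂ := -Complex.I * v / ‖v‖ with hu
  have hun : ‖u‖ = 1 := by
    rw [hu, norm_div, norm_mul]
    simp [hv0]
  set x : ℂ := u - e d₀ with hx
  set χ := trackCocycle t with hχdef
  have hχ : G.IsParallelogramCocycle χ := isParallelogramCocycle_trackCocycle t
  have hc : G.IsParallelogramCocycle (e + x • χ) := he.add (hχ.smul x)
  have hsep : ∀ d, G.track d = t → G.track (G.rev d) ≠ t := by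
    intro d h1 h2
    have a1 := he.track_congr (h1.trans ht)
    have a2 := he.track_congr (h2.trans ht)
    rw [he.rev, a1] at a2
    have := hn d₀
    rw [neg_eq_self.1 a2] at this
    simp at this
  have hcn : ∀ d, ‖(e + x • χ) d‖ = 1 := by
    intro d
    simp only [Pi.add_apply, Pi.smul_apply, smul_eq_mul, hχdef, trackCocycle]
    by_cases h1 : G.track d = t
    · rw [if_pos h1, if_neg (hsep d h1), he.track_congr (h1.trans ht), hx]
      simpa using hun
    · rw [if_neg h1]
      by_cases h2 : G.track (G.rev d) = t
      · have := he.track_congr (h2.trans ht)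
        rw [he.rev] at this
        rw [if_pos h2, ← neg_neg (e d), this, hx]
        have e1 : -e d₀ + (u - e d₀ ) * (0 - 1) = -u := by ring
        rw [e1, norm_neg, hun]
      · rw [if_neg h2]
        simp [hn]
  have hle := hmax _ hc hcn
  have hsχ : star χ = χ := by
    ext d
    simp only [hχdef, trackCocycle, Pi.star_apply]
    split_ifs <;> simp
  have hvs : trackSum (star e) t = star v := by simp [hv, trackSum]
  have p1 : G.pair χ (star e) = 2 * star v := by rw [pair_trackCocycle he.star, hvs]
  have p2 : G.pair e χ = -(2 * v) := by rw [pair_antisymm he, pair_trackCocycle he]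
  -- There is no quadratic term because `χ` pairs to zero with itself. So the area is affine in the
  -- new transversal and a finite change can be compared directly.
  have hpair : G.pair (e + x • χ) (star (e + x • χ))
      = G.pair e (star e) + (2 * (x * star v) - 2 * (star x * v)) := by
    have : star (e + x • χ) = star e + star x • χ := by
      rw [star_add, star_smul, hsχ]
    rw [this]
    simp only [pair_add_left, pair_add_right, pair_smul_left, pair_smul_right, pair_self hχ, p1, p2]
    ring
  rw [pair_star_self hc, pair_star_self he] at hpair
  have him := congrArg Complex.im hpair
  simp only [Complex.add_im, Complex.sub_im, Complex.mul_im, Complex.neg_im, Complex.neg_re,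
    Complex.I_im, Complex.I_re, Complex.ofReal_re, Complex.ofReal_im, Complex.star_def,
    Complex.conj_re, Complex.conj_im, Complex.re_ofNat, Complex.im_ofNat, Complex.mul_re] at him
  have hineq : (star u * v).im ≤ (star (e d₀) * v).im := by
    simp only [hx, Complex.sub_re, Complex.sub_im] at him
    simp only [Complex.mul_im, Complex.star_def, Complex.conj_re, Complex.conj_im]
    linarith
  have huv : star u * v = Complex.I * ‖v‖ := by
    rw [hu]
    simp only [star_div₀, star_mul', star_neg, Complex.star_def, Complex.conj_I,
      Complex.conj_ofReal]
    rw [div_mul_eq_mul_div, div_eq_iff hvn]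
    have := Complex.normSq_eq_conj_mul_self (z := v)
    rw [Complex.normSq_eq_norm_sq] at this
    push_cast at this
    linear_combination -Complex.I * this
  rw [huv] at hineq
  simp only [Complex.mul_im, Complex.I_re, Complex.I_im, Complex.ofReal_re, Complex.ofReal_im] at hineq
  have hnorm : ‖star (e d₀) * v‖ = ‖v‖ := by rw [norm_mul, norm_star, hn, one_mul]
  have h1 := Complex.im_le_norm (star (e d₀) * v)
  have h2 : (star (e d₀) * v).im = ‖v‖ := le_antisymm (by rwa [hnorm] at h1) (by
    simp only [Complex.mul_im] at hineq ⊢; linarith)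
  have h3 := Complex.sq_norm (star (e d₀) * v)
  rw [hnorm, Complex.normSq_apply, h2] at h3
  have h4 : (star (e d₀) * v).re = 0 := by nlinarith
  apply Complex.ext
  · rw [h4]; simp
  · rw [h2]; simp

/-- There is a rhombic cocycle which maximizes the area among all unit cocycles. -/
theorem IsRhombic.exists_isMax {e₀ : D → ℂ} (h₀ : G.IsRhombic e₀) :
    ∃ e, G.IsRhombic e ∧ ∀ c, G.IsParallelogramCocycle c → (∀ d, ‖c d‖ = 1) →
      G.totalArea c ≤ G.totalArea e := by
  -- Positivity of the faces is dropped to make the set compact and is recovered at the maximizer.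
  let K : Set (D → ℂ) := {c | G.IsParallelogramCocycle c ∧ ∀ d, ‖c d‖ = 1}
  have hK : IsCompact K := by
    refine Metric.isCompact_of_isClosed_isBounded ?_ ?_
    · have : K = (⋂ d, {c | c (G.rev d) = -c d}) ∩ (⋂ d, {c | c (G.next (G.next d)) = -c d})
          ∩ ⋂ d, {c | ‖c d‖ = 1} := by
        ext c
        simp only [K, Set.mem_inter_iff, Set.mem_iInter, Set.mem_ofPred_eq]
        exact ⟨fun h => ⟨⟨h.1.1, h.1.2⟩, h.2⟩, fun h => ⟨⟨h.1.1, h.1.2⟩, h.2⟩⟩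
      rw [this]
      refine ((isClosed_iInter fun d => ?_).inter (isClosed_iInter fun d => ?_)).inter
        (isClosed_iInter fun d => ?_)
      · exact isClosed_eq (by fun_prop) (by fun_prop)
      · exact isClosed_eq (by fun_prop) (by fun_prop)
      · exact isClosed_eq (by fun_prop) (by fun_prop)
    · refine (Metric.isBounded_closedBall (x := (0 : D → ℂ)) (r := 1)).subset fun c hc => ?_
      rw [mem_closedBall_zero_iff, pi_norm_le_iff_of_nonneg zero_le_one]
      exact fun d => (hc.2 d).le
  have hcont : Continuous (G.totalArea) := by
    unfold totalArea
    exact continuous_finsetSum _ fun d _ => Complex.continuous_im.comp (by fun_prop)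
  obtain ⟨e, ⟨he, hn⟩, hmax⟩ := hK.exists_isMaxOn ⟨e₀, h₀.1, h₀.norm⟩ hcont.continuousOn
  have hmax' : ∀ c, G.IsParallelogramCocycle c → (∀ d, ‖c d‖ = 1) →
      G.totalArea c ≤ G.totalArea e := fun c hc hcn => hmax ⟨hc, hcn⟩
  refine ⟨e, ⟨he, hn, fun d => ?_⟩, hmax'⟩
  obtain ⟨a, b, g, h⟩ := h₀.exists_combination he
  -- The maximizer has at least the positive area of `e₀`.
  have hdet : 0 < Complex.normSq a - Complex.normSq b := by
    have h1 := totalArea_combination h₀.1 he h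
    have p0 := h₀.totalArea_pos
    have p1 := lt_of_lt_of_le p0 (hmax' _ h₀.1 h₀.norm)
    rw [h1] at p1
    exact (mul_pos_iff_of_pos_right p0).1 p1
  have hw := trackSum_combination h₀.1 he h
  have hcross : 0 < (star (trackSum e (G.track d)) * trackSum e (G.track (G.next d))).im := by
    have h1 : (star (trackSum e (G.track d)) * trackSum e (G.track (G.next d))).im
        = (Complex.normSq a - Complex.normSq b) *
          (star (trackSum e₀ (G.track d)) * trackSum e₀ (G.track (G.next d))).im := by
      rw [hw, hw, Complex.normSq_apply, Complex.normSq_apply]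
      simp only [Complex.add_im, Complex.mul_im, Complex.add_re, Complex.mul_re,
        Complex.star_def, Complex.conj_re, Complex.conj_im]
      ring
    rw [h1]
    exact mul_pos hdet (h₀.trackSum_cross_pos d)
  -- All edges are thus obtained from asymptotic vectors by the same quarter turn and a nonnegative
  -- scaling, so faces inherit the orientation of crossing tracks.
  have hform : ∀ d, trackSum e (G.track d) = e d * (Complex.I * ‖trackSum e (G.track d)‖) := by
    intro d
    rw [← star_mul_trackSum_of_isMax he hn hmax' d, ← mul_assoc]
    have : e d * star (e d) = 1 := by
      rw [Complex.star_def, Complex.mul_conj, Complex.normSq_eq_norm_sq, hn]; simp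
    rw [this, one_mul]
  have hnorm : (star (trackSum e (G.track d)) * trackSum e (G.track (G.next d))).im
      = (‖trackSum e (G.track d)‖ * ‖trackSum e (G.track (G.next d))‖)
        * (star (e d) * e (G.next d)).im := by
    have aux : ∀ (z w p q : ℂ) (r s : ℝ), p = z * (Complex.I * r) → q = w * (Complex.I * s) →
        (star p * q).im = (r * s) * (star z * w).im := by
      rintro z w _ _ r s rfl rfl
      rw [← Complex.im_ofReal_mul]
      congr 1
      simp only [star_mul', Complex.star_def, Complex.conj_I, Complex.conj_ofReal]
      push_cast
      linear_combination -(starRingEnd ℂ z * w * r * s) * Complex.I_sq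
    exact aux _ _ _ _ _ _ (hform d) (hform (G.next d))
  rw [hnorm] at hcross
  rw [he.rot, div_eq_star_mul (hn d)]
  exact pos_of_mul_pos_right hcross (by positivity)

end Maximum

end TorusQuadrangulation

namespace TorusQuadrangulation

open Topology

/-! ### Oblique coordinates in the plane -/

section Coordinates

/-- The first coordinate with respect to the basis `a`, `b` of the plane. -/
noncomputable def coordX (a b z : ℂ) : ℝ := (star z * b).im / (star a * b).im

/-- The second coordinate with respect to the basis `a`, `b` of the plane. -/
noncomputable def coordY (a b z : ℂ) : ℝ := (star a * z).im / (star a * b).im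

theorem star_mul_im (z w : ℂ) : (star z * w).im = z.re * w.im - z.im * w.re := by
  simp [Complex.mul_im]; ring

variable {a b : ℂ}

theorem coordX_mul_add (h : (star a * b).im ≠ 0) (z : ℂ) :
    (coordX a b z : ℂ) * a + (coordY a b z : ℂ) * b = z := by
  have hx : coordX a b z * (star a * b).im = (star z * b).im := div_mul_cancel₀ _ h
  have hy : coordY a b z * (star a * b).im = (star a * z).im := div_mul_cancel₀ _ h
  rw [star_mul_im, star_mul_im] at hx hy
  rw [star_mul_im] at h
  apply Complex.ext
  · apply mul_left_cancel₀ h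
    rw [Complex.add_re, Complex.re_ofReal_mul, Complex.re_ofReal_mul]
    linear_combination a.re * hx + b.re * hy
  · apply mul_left_cancel₀ h
    rw [Complex.add_im, Complex.im_ofReal_mul, Complex.im_ofReal_mul]
    linear_combination a.im * hx + b.im * hy

theorem coordX_combination (h : (star a * b).im ≠ 0) (s t : ℝ) :
    coordX a b (s * a + t * b) = s := by
  rw [coordX, div_eq_iff h]
  simp only [star_mul_im]
  simp
  ring

theorem coordY_combination (h : (star a * b).im ≠ 0) (s t : ℝ) :
    coordY a b (s * a + t * b) = t := by
  rw [coordY, div_eq_iff h]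
  simp only [star_mul_im]
  simp
  ring

@[fun_prop]
theorem continuous_coordX : Continuous (coordX a b) := by
  unfold coordX
  exact (Complex.continuous_im.comp (by fun_prop)).div_const _

@[fun_prop]
theorem continuous_coordY : Continuous (coordY a b) := by
  unfold coordY
  exact (Complex.continuous_im.comp (by fun_prop)).div_const _

theorem coordX_zero : coordX a b 0 = 0 := by simp [coordX]

theorem coordY_zero : coordY a b 0 = 0 := by simp [coordY]

theorem coordX_add (z w : ℂ) : coordX a b (z + w) = coordX a b z + coordX a b w := by
  simp [coordX, add_mul, add_div]

theorem coordY_add (z w : ℂ) : coordY a b (z + w) = coordY a b z + coordY a b w := by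
  simp [coordY, mul_add, add_div]

theorem coordX_real_mul (r : ℝ) (z : ℂ) : coordX a b (r * z) = r * coordX a b z := by
  simp only [coordX, star_mul_im]
  simp
  ring

theorem coordY_real_mul (r : ℝ) (z : ℂ) : coordY a b (r * z) = r * coordY a b z := by
  simp only [coordY, star_mul_im]
  simp
  ring

end Coordinates

variable {D : Type*} [Fintype D] {G : TorusQuadrangulation D}

/-! ### Faces of a locally rhombic drawing cover the torus -/

section Cones

theorem IsRhombic.area_pos {e : D → ℂ} (he : G.IsRhombic e) (d : D) :
    0 < (star (e d) * e (G.rot d)).im := by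
  rw [he.rot]; exact he.star_mul_pos d

/-- The wedges at a vertex cover all directions. -/
theorem IsRhombic.exists_cone {e : D → ℂ} (he : G.IsRhombic e) (z : ℂ) (d : D) :
    ∃ d', G.tail d' = G.tail d ∧ 0 ≤ coordX (e d') (e (G.rot d')) z ∧
      0 ≤ coordY (e d') (e (G.rot d')) z := by
  by_contra hcon
  push Not at hcon
  -- If no wedge contains `z`, an edge once on the right of `z` or parallel to it is followed only
  -- by edges strictly on its right. Going around the vertex, all edges lie strictly on one side.
  have hno : ∀ d', G.tail d' = G.tail d → (star z * e d').im ≤ 0 →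
      (star z * e (G.rot d')).im < 0 := by
    intro d' hd' h1
    have hJ := he.area_pos d'
    by_contra h2
    push Not at h2
    have h3 := hcon d' hd' (div_nonneg h2 hJ.le)
    refine absurd h3 (not_lt.2 (div_nonneg ?_ hJ.le))
    rw [star_mul_im] at h1 ⊢
    linarith
  have hsign : (∀ d', G.tail d' = G.tail d → 0 < (star z * e d').im) ∨
      (∀ d', G.tail d' = G.tail d → (star z * e d').im < 0) := by
    by_cases hall : ∀ d', G.tail d' = G.tail d → 0 < (star z * e d').im
    · exact Or.inl hall
    · push Not at hall
      obtain ⟨d₁, hd₁, h₁⟩ := hall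
      right
      have key : ∀ n : ℕ, G.tail ((G.rot ^ n) (G.rot d₁)) = G.tail d ∧
          (star z * e ((G.rot ^ n) (G.rot d₁))).im < 0 := by
        intro n
        induction n with
        | zero => exact ⟨(tail_rot G d₁).trans hd₁, hno _ hd₁ h₁⟩
        | succ k ih =>
          rw [pow_succ', Equiv.Perm.mul_apply]
          exact ⟨(tail_rot G _).trans ih.1, hno _ ih.1 ih.2.le⟩
      intro d' hd'
      have hsc : G.rot.SameCycle (G.rot d₁) d' :=
        Quotient.exact (((tail_rot G d₁).trans hd₁).trans hd'.symm)
      obtain ⟨n, -, hn⟩ := hsc.exists_pow_eq'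
      rw [← hn]
      exact (key n).2
  have hmul : ∀ d', G.tail d' = G.tail d →
      0 < (star z * e d').im * (star z * e (G.rot d')).im := by
    intro d' hd'
    have hd'' := (tail_rot G d').trans hd'
    rcases hsign with h | h
    · exact mul_pos (h _ hd') (h _ hd'')
    · exact mul_pos_of_neg_of_neg (h _ hd') (h _ hd'')
  -- The cotangent of the angle from `z` would strictly decrease along the finite cycle of edges at
  -- the vertex, which is impossible.
  have hdec : ∀ d', G.tail d' = G.tail d →
      (star z * e (G.rot d')).re / (star z * e (G.rot d')).im
        < (star z * e d').re / (star z * e d').im := by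
    intro d' hd'
    have h := hmul d' hd'
    have h1 : (star z * e d').im ≠ 0 := left_ne_zero_of_mul h.ne'
    have h2 : (star z * e (G.rot d')).im ≠ 0 := right_ne_zero_of_mul h.ne'
    have hz : 0 < Complex.normSq z := by
      refine Complex.normSq_pos.2 ?_
      rintro rfl
      simp at h1
    have hJ := mul_pos hz (he.area_pos d')
    have hid : Complex.normSq z * (star (e d') * e (G.rot d')).im
        = (star z * e d').re * (star z * e (G.rot d')).im
          - (star z * e d').im * (star z * e (G.rot d')).re := by
      rw [Complex.normSq_apply]
      simp [Complex.mul_im]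
      ring
    rw [← sub_pos, div_sub_div _ _ h1 h2]
    exact div_pos (by rw [← hid]; exact hJ) h
  have : Nonempty {d' // G.tail d' = G.tail d} := ⟨⟨d, rfl⟩⟩
  obtain ⟨⟨m, hm⟩, hmin⟩ := Finite.exists_min
    (fun x : {d' // G.tail d' = G.tail d} => (star z * e x.1).re / (star z * e x.1).im)
  have h1 := hmin ⟨G.rot m, (tail_rot G m).trans hm⟩
  have h2 := hdec m hm
  simp only at h1
  exact absurd h2 (not_lt.2 h1)

end Cones

namespace UnitDrawing

variable (U : UnitDrawing G)

theorem facePoint_zero (d : D) (s : ℝ) : U.facePoint d s 0 = U.edgePoint d s := by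
  simp [facePoint, edgePoint]

theorem edgePoint_zero (d : D) : U.edgePoint d 0 = U.pos (G.tail d) := by
  simp [edgePoint]

theorem facePoint_rot (d : D) (t : ℝ) : U.facePoint d 0 t = U.edgePoint (G.rot d) t := by
  simp [facePoint, edgePoint, tail_rot]

theorem edgePoint_rev (d : D) (s : ℝ) : U.edgePoint (G.rev d) s = U.edgePoint d (1 - s) := by
  rw [edgePoint, edgePoint, U.pos_head, add_assoc, ← QuotientAddGroup.mk_add, U.edge_rev]
  congr 2
  push_cast
  ring

variable {U}

theorem facePoint_next (hU : G.IsRhombic U.edge) (d : D) (s t : ℝ) :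
    U.facePoint (G.next d) s t = U.facePoint d (1 - t) s := by
  rw [facePoint, facePoint, tail_next, U.pos_head, add_assoc, ← QuotientAddGroup.mk_add,
    rot_next, U.edge_rev, hU.rot]
  congr 2
  push_cast
  ring

theorem facePoint_add (hU : G.IsRhombic U.edge) (d : D) (s t : ℝ) (z : ℂ) :
    U.facePoint d s t + QuotientAddGroup.mk z
      = U.facePoint d (s + coordX (U.edge d) (U.edge (G.rot d)) z)
          (t + coordY (U.edge d) (U.edge (G.rot d)) z) := by
  rw [facePoint, facePoint, add_assoc, ← QuotientAddGroup.mk_add]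
  congr 2
  conv_lhs => rw [← coordX_mul_add (hU.area_pos d).ne' z]
  push_cast
  ring

theorem edgePoint_add (hU : G.IsRhombic U.edge) (d : D) (s : ℝ) (z : ℂ) :
    U.edgePoint d s + QuotientAddGroup.mk z
      = U.facePoint d (s + coordX (U.edge d) (U.edge (G.rot d)) z)
          (coordY (U.edge d) (U.edge (G.rot d)) z) := by
  rw [← facePoint_zero, facePoint_add hU, zero_add]

/-- Every point of the boundary of a face lies on a half-open edge. -/
theorem exists_edgePoint (hU : G.IsRhombic U.edge) (d : D) {s t : ℝ} (hs : s ∈ Set.Icc (0 : ℝ) 1)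
    (ht : t ∈ Set.Icc (0 : ℝ) 1) (h : ¬(s ∈ Set.Ioo (0 : ℝ) 1 ∧ t ∈ Set.Ioo (0 : ℝ) 1)) :
    ∃ d', ∃ s' ∈ Set.Ico (0 : ℝ) 1, U.facePoint d s t = U.edgePoint d' s' := by
  have hedge : ∀ d', ∀ s' ∈ Set.Icc (0 : ℝ) 1, ∃ d'', ∃ s'' ∈ Set.Ico (0 : ℝ) 1,
      U.edgePoint d' s' = U.edgePoint d'' s'' := by
    intro d' s' hs'
    rcases eq_or_lt_of_le hs'.2 with rfl | h1
    · refine ⟨G.rev d', 0, by simp, ?_⟩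
      rw [edgePoint_rev, sub_zero]
    · exact ⟨d', s', ⟨hs'.1, h1⟩, rfl⟩
  have key : ∃ d', ∃ s' ∈ Set.Icc (0 : ℝ) 1, U.facePoint d s t = U.edgePoint d' s' := by
    rcases eq_or_lt_of_le hs.1 with rfl | h1
    · exact ⟨_, t, ht, U.facePoint_rot d t⟩
    rcases eq_or_lt_of_le ht.1 with rfl | h2
    · exact ⟨_, s, hs, U.facePoint_zero d s⟩
    rcases eq_or_lt_of_le hs.2 with rfl | h3
    · refine ⟨G.next d, t, ht, ?_⟩
      rw [← facePoint_zero, facePoint_next hU, sub_zero]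
    rcases eq_or_lt_of_le ht.2 with rfl | h4
    · refine ⟨G.next (G.next d), 1 - s, ⟨by linarith, by linarith⟩, ?_⟩
      rw [← facePoint_zero, facePoint_next hU, facePoint_next hU, sub_zero, sub_sub_cancel]
    · exact absurd ⟨⟨h1, h3⟩, h2, h4⟩ h
  obtain ⟨d', s', hs', h'⟩ := key
  obtain ⟨d'', s'', hs'', h''⟩ := hedge d' s' hs'
  exact ⟨d'', s'', hs'', h'.trans h''⟩

variable (U) in
/-- The union of the closed faces. -/
def support : Set (ℂ ⧸ U.Λ.toAddSubgroup) :=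
  {x | ∃ d : D, ∃ s ∈ Set.Icc (0 : ℝ) 1, ∃ t ∈ Set.Icc (0 : ℝ) 1, U.facePoint d s t = x}

theorem mem_nhds_of_eventually (x : ℂ ⧸ U.Λ.toAddSubgroup) {K : Set (ℂ ⧸ U.Λ.toAddSubgroup)}
    (h : ∀ᶠ z in 𝓝 (0 : ℂ), x + QuotientAddGroup.mk z ∈ K) : K ∈ 𝓝 x := by
  have hopen : IsOpenMap (fun z : ℂ => x + (QuotientAddGroup.mk z : ℂ ⧸ U.Λ.toAddSubgroup)) :=
    (Homeomorph.addLeft x).isOpenMap.comp QuotientAddGroup.isOpenMap_coe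
  have := hopen.nhds_le 0
  simp only [QuotientAddGroup.mk_zero, add_zero] at this
  exact this h

theorem eventually_coord_small (U : UnitDrawing G) {ε : ℝ} (hε : 0 < ε) :
    ∀ᶠ z in 𝓝 (0 : ℂ), ∀ d : D, |coordX (U.edge d) (U.edge (G.rot d)) z| < ε ∧
      |coordY (U.edge d) (U.edge (G.rot d)) z| < ε := by
  rw [Filter.eventually_all]
  intro d
  refine Filter.Eventually.and ?_ ?_
  · have : Filter.Tendsto (fun z => |coordX (U.edge d) (U.edge (G.rot d)) z|) (𝓝 0) (𝓝 0) := by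
      have := (continuous_coordX (a := U.edge d) (b := U.edge (G.rot d))).abs.tendsto 0
      simpa [coordX_zero] using this
    exact this.eventually (gt_mem_nhds hε)
  · have : Filter.Tendsto (fun z => |coordY (U.edge d) (U.edge (G.rot d)) z|) (𝓝 0) (𝓝 0) := by
      have := (continuous_coordY (a := U.edge d) (b := U.edge (G.rot d))).abs.tendsto 0
      simpa [coordY_zero] using this
    exact this.eventually (gt_mem_nhds hε)

/-- A neighbourhood of a point is filled by one face in an open face, by the faces on both sides at
an edge, and by the wedges of `exists_cone` at a vertex. -/
theorem isOpen_support (hU : G.IsRhombic U.edge) : IsOpen U.support := by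
  rw [isOpen_iff_mem_nhds]
  rintro x ⟨d, s, hs, t, ht, rfl⟩
  by_cases hin : s ∈ Set.Ioo (0 : ℝ) 1 ∧ t ∈ Set.Ioo (0 : ℝ) 1
  · obtain ⟨⟨s0, s1⟩, t0, t1⟩ := hin
    refine mem_nhds_of_eventually _ ?_
    have hε : 0 < min (min s (1 - s)) (min t (1 - t)) := by
      simp only [lt_min_iff]; exact ⟨⟨s0, by linarith⟩, t0, by linarith⟩
    filter_upwards [U.eventually_coord_small hε] with z hz
    obtain ⟨hx, hy⟩ := hz d
    simp only [lt_min_iff, abs_lt] at hx hy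
    refine ⟨d, _, ?_, _, ?_, (facePoint_add hU d s t z).symm⟩
    · constructor <;> linarith [hx.1.1.1, hx.1.2.2]
    · constructor <;> linarith [hy.2.1.1, hy.2.2.2]
  · obtain ⟨d', s', ⟨h0, h1⟩, h⟩ := exists_edgePoint hU d hs ht hin
    rw [h]
    refine mem_nhds_of_eventually _ ?_
    rcases eq_or_lt_of_le h0 with rfl | h0
    · filter_upwards [U.eventually_coord_small one_pos] with z hz
      obtain ⟨d'', hd'', hx0, hy0⟩ := hU.exists_cone z d'
      obtain ⟨hx, hy⟩ := hz d''
      rw [abs_lt] at hx hy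
      refine ⟨d'', _, ⟨hx0, hx.2.le⟩, _, ⟨hy0, hy.2.le⟩, ?_⟩
      rw [edgePoint_zero, ← hd'', ← edgePoint_zero, edgePoint_add hU, zero_add]
    · have hε : 0 < min s' (1 - s') := lt_min h0 (by linarith)
      filter_upwards [U.eventually_coord_small hε, U.eventually_coord_small one_pos] with z hz hz1
      rcases le_or_gt 0 (coordY (U.edge d') (U.edge (G.rot d')) z) with hy | hy
      · obtain ⟨hx, -⟩ := hz d'
        have hy1 := (hz1 d').2
        simp only [lt_min_iff, abs_lt] at hx hy1
        refine ⟨d', _, ?_, _, ⟨hy, hy1.2.le⟩, (edgePoint_add hU d' s' z).symm⟩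
        constructor <;> linarith [hx.1.1, hx.2.2]
      · obtain ⟨hx, -⟩ := hz (G.rev d')
        have hy1 := (hz1 (G.rev d')).2
        simp only [lt_min_iff, abs_lt] at hx hy1
        have hy' : 0 ≤ coordY (U.edge (G.rev d')) (U.edge (G.rot (G.rev d'))) z := by
          refine div_nonneg ?_ (hU.area_pos _).le
          have := (div_neg_iff.1 hy).resolve_left fun h => absurd h.2 (not_lt.2 (hU.area_pos _).le)
          rw [U.edge_rev, star_neg, neg_mul, Complex.neg_im]
          linarith [this.1]
        refine ⟨G.rev d', 1 - s' + coordX (U.edge (G.rev d')) (U.edge (G.rot (G.rev d'))) z,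
          ?_, _, ⟨hy', hy1.2.le⟩, ?_⟩
        · constructor <;> linarith [hx.1.2, hx.2.1]
        · have := edgePoint_rev U d' (1 - s')
          rw [sub_sub_cancel] at this
          rw [← this]
          exact (edgePoint_add hU (G.rev d') (1 - s') z).symm

theorem isClosed_support (U : UnitDrawing G) : IsClosed U.support := by
  have hdisc : DiscreteTopology U.Λ.toAddSubgroup := U.discrete
  have hcl : IsClosed (U.Λ.toAddSubgroup : Set ℂ) := AddSubgroup.isClosed_of_discrete
  have : U.support = ⋃ d : D, (fun p : ℝ × ℝ => U.facePoint d p.1 p.2) ''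
      (Set.Icc (0 : ℝ) 1 ×ˢ Set.Icc (0 : ℝ) 1) := by
    ext x
    simp only [support, Set.mem_ofPred_eq, Set.mem_iUnion, Set.mem_image, Set.mem_prod, Prod.exists]
    exact ⟨fun ⟨d, s, hs, t, ht, h⟩ => ⟨d, s, t, ⟨hs, ht⟩, h⟩,
      fun ⟨d, s, t, ⟨hs, ht⟩, h⟩ => ⟨d, s, hs, t, ht, h⟩⟩
  rw [this]
  refine (isCompact_iUnion fun d => ?_).isClosed
  refine (isCompact_Icc.prod isCompact_Icc).image ?_
  unfold facePoint
  refine continuous_const.add (QuotientAddGroup.continuous_mk.comp ?_)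
  fun_prop

/-- The closed faces of a locally rhombic drawing cover the torus. -/
theorem support_eq_univ (hU : G.IsRhombic U.edge) : U.support = Set.univ := by
  have : ConnectedSpace (ℂ ⧸ U.Λ.toAddSubgroup) :=
    (QuotientAddGroup.mk_surjective).connectedSpace QuotientAddGroup.continuous_mk
  obtain ⟨d⟩ := G.nonempty
  exact IsClopen.eq_univ ⟨U.isClosed_support, isOpen_support hU⟩
    ⟨_, d, 0, by simp, 0, by simp, rfl⟩

end UnitDrawing

end TorusQuadrangulation

namespace TorusQuadrangulation

open Topology MeasureTheory
open scoped ENNReal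

/-! ### Areas, covering multiplicities and disjointness of faces -/

section Parallelogram

theorem volume_reProdIm (s t : Set ℝ) :
    volume (s ×ℂ t) = volume s * volume t := by
  have h : s ×ℂ t = Complex.measurableEquivRealProd ⁻¹' (s ×ˢ t) := by
    ext z; simp [Complex.mem_reProdIm]
  rw [h, Complex.volume_preserving_equiv_real_prod.measure_preimage_equiv,
    Measure.volume_eq_prod, Measure.prod_prod]

/-- The area of a parallelogram. -/
theorem volume_coord_preimage {a b : ℂ} (h : 0 < (star a * b).im) (p : ℂ) {I : Set ℝ}
    (hI : volume I = 1) :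
    volume {z | coordX a b (z - p) ∈ I ∧ coordY a b (z - p) ∈ I}
      = ENNReal.ofReal (star a * b).im := by
  let T : ℂ →ₗ[ℝ] ℂ :=
    { toFun := fun z => ⟨coordX a b z, coordY a b z⟩
      map_add' := fun z w => by
        apply Complex.ext
        · exact coordX_add z w
        · exact coordY_add z w
      map_smul' := fun r z => by
        apply Complex.ext
        · simpa using coordX_real_mul r z
        · simpa using coordY_real_mul r z }
  have hT : LinearMap.det T = (star a * b).im⁻¹ := by
    rw [← LinearMap.det_toMatrix Complex.basisOneI, Matrix.det_fin_two]
    simp only [LinearMap.toMatrix_apply, T, LinearMap.coe_mk, AddHom.coe_mk,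
      Complex.coe_basisOneI, Complex.coe_basisOneI_repr, Matrix.cons_val_zero, Matrix.cons_val_one,
      coordX, coordY]
    have h' := h.ne'
    rw [star_mul_im] at h' ⊢
    simp only [star_mul_im]
    simp
    field_simp
  have hset : {z | coordX a b (z - p) ∈ I ∧ coordY a b (z - p) ∈ I}
      = (fun z => z + (-p)) ⁻¹' (T ⁻¹' (I ×ℂ I)) := by
    ext z
    simp [T, Complex.mem_reProdIm, sub_eq_add_neg]
  rw [hset, measure_preimage_add_right, Measure.addHaar_preimage_linearMap _ (by
    rw [hT]; exact inv_ne_zero h.ne'), hT, volume_reProdIm, hI, inv_inv, abs_of_pos h]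
  simp

end Parallelogram

variable {D : Type*} [Fintype D] {G : TorusQuadrangulation D}

namespace UnitDrawing

variable (U : UnitDrawing G)

/-- A lift to the plane of the tail of a dart. -/
noncomputable def lift (d : D) : ℂ := (U.pos (G.tail d)).out

theorem mk_lift (d : D) : (QuotientAddGroup.mk (U.lift d) : ℂ ⧸ U.Λ.toAddSubgroup)
    = U.pos (G.tail d) := QuotientAddGroup.out_eq' _

/-- The points of a lift of the face to the left of `d` whose coordinates lie in `I`. -/
def cell (I : Set ℝ) (d : D) : Set ℂ :=
  {z | coordX (U.edge d) (U.edge (G.rot d)) (z - U.lift d) ∈ I ∧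
    coordY (U.edge d) (U.edge (G.rot d)) (z - U.lift d) ∈ I}

/-- The number of translates of a plane set which contain a given point. -/
noncomputable def multiplicity (P : Set ℂ) (x : ℂ) : ℝ≥0∞ :=
  ∑' g : U.Λ, P.indicator 1 ((g : ℂ) + x)

variable {U}

theorem mk_eq_facePoint (hU : G.IsRhombic U.edge) (d : D) (z : ℂ) :
    (QuotientAddGroup.mk z : ℂ ⧸ U.Λ.toAddSubgroup) = U.facePoint d
      (coordX (U.edge d) (U.edge (G.rot d)) (z - U.lift d))
      (coordY (U.edge d) (U.edge (G.rot d)) (z - U.lift d)) := by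
  rw [facePoint, coordX_mul_add (hU.area_pos d).ne', ← mk_lift, ← QuotientAddGroup.mk_add,
    add_sub_cancel]

theorem mk_facePoint (hU : G.IsRhombic U.edge) (I : Set ℝ) (d : D) {s t : ℝ} (hs : s ∈ I)
    (ht : t ∈ I) :
    U.lift d + ((s : ℂ) * U.edge d + (t : ℂ) * U.edge (G.rot d)) ∈ U.cell I d ∧
      (QuotientAddGroup.mk (U.lift d + ((s : ℂ) * U.edge d + (t : ℂ) * U.edge (G.rot d))) :
        ℂ ⧸ U.Λ.toAddSubgroup) = U.facePoint d s t := by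
  constructor
  · simp only [cell, Set.mem_ofPred_eq, add_sub_cancel_left]
    rw [coordX_combination (hU.area_pos d).ne', coordY_combination (hU.area_pos d).ne']
    exact ⟨hs, ht⟩
  · rw [QuotientAddGroup.mk_add, mk_lift, facePoint]

theorem mk_eq_mk_iff {x y : ℂ} : (QuotientAddGroup.mk x : ℂ ⧸ U.Λ.toAddSubgroup)
    = QuotientAddGroup.mk y ↔ y - x ∈ U.Λ := by
  rw [QuotientAddGroup.eq, neg_add_eq_sub]; rfl

theorem one_le_multiplicity {P : Set ℂ} {x : ℂ} (g : U.Λ) (hg : (g : ℂ) + x ∈ P) :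
    1 ≤ U.multiplicity P x := by
  refine le_trans ?_ (ENNReal.le_tsum g)
  rw [Set.indicator_of_mem hg]; rfl

theorem two_le_multiplicity {P : Set ℂ} {x : ℂ} {g g' : U.Λ} (hne : g ≠ g')
    (hg : (g : ℂ) + x ∈ P) (hg' : (g' : ℂ) + x ∈ P) :
    2 ≤ U.multiplicity P x := by
  classical
  refine le_trans ?_ (ENNReal.sum_le_tsum {g, g'})
  rw [Finset.sum_pair hne, Set.indicator_of_mem hg, Set.indicator_of_mem hg']
  simp only [Pi.one_apply]
  norm_num

theorem one_le_multiplicity_cell (hU : G.IsRhombic U.edge) {I : Set ℝ} {d : D} {x : ℂ} {s t : ℝ}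
    (hs : s ∈ I) (ht : t ∈ I)
    (h : U.facePoint d s t = (QuotientAddGroup.mk x : ℂ ⧸ U.Λ.toAddSubgroup)) :
    1 ≤ U.multiplicity (U.cell I d) x := by
  obtain ⟨h1, h2⟩ := mk_facePoint hU I d hs ht
  rw [← h2, eq_comm, mk_eq_mk_iff] at h
  exact one_le_multiplicity ⟨_, h⟩ (by simpa using h1)

theorem multiplicity_add (P : Set ℂ) (g : U.Λ) (x : ℂ) :
    U.multiplicity P ((g : ℂ) + x) = U.multiplicity P x := by
  unfold multiplicity
  rw [← (Equiv.addRight g).tsum_eq (fun g' : U.Λ => P.indicator 1 ((g' : ℂ) + x))]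
  simp [add_assoc]

theorem measurableSet_cell (I : Set ℝ) (hI : MeasurableSet I) (d : D) :
    MeasurableSet (U.cell I d) := by
  have h1 : Measurable fun z => coordX (U.edge d) (U.edge (G.rot d)) (z - U.lift d) :=
    Continuous.measurable (by fun_prop)
  have h2 : Measurable fun z => coordY (U.edge d) (U.edge (G.rot d)) (z - U.lift d) :=
    Continuous.measurable (by fun_prop)
  exact (h1 hI).inter (h2 hI)

theorem isOpen_cell (d : D) : IsOpen (U.cell (Set.Ioo 0 1) d) := by
  have h1 : Continuous fun z => coordX (U.edge d) (U.edge (G.rot d)) (z - U.lift d) := by fun_prop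
  have h2 : Continuous fun z => coordY (U.edge d) (U.edge (G.rot d)) (z - U.lift d) := by fun_prop
  exact (isOpen_Ioo.preimage h1).inter (isOpen_Ioo.preimage h2)

variable (U)

theorem countable_lattice : Countable U.Λ := by
  have := U.discrete
  have := U.lattice
  exact inferInstance

theorem measurable_multiplicity {P : Set ℂ} (hP : MeasurableSet P) :
    Measurable (U.multiplicity P) := by
  have := U.countable_lattice
  refine Measurable.tsum fun g => ?_
  exact (measurable_one.indicator hP).comp (measurable_const_add _)

/-- A fundamental domain of the lattice, and the volume of a plane set computed on it. -/
theorem exists_fundamentalDomain :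
    ∃ F : Set ℂ, IsAddFundamentalDomain U.Λ F volume ∧
      volume F = ENNReal.ofReal (ZLattice.covolume U.Λ volume) ∧
      ∀ P : Set ℂ, MeasurableSet P → volume P = ∫⁻ x in F, U.multiplicity P x := by
  have := U.discrete
  have := U.lattice
  have := U.countable_lattice
  have : MeasurableVAdd U.Λ ℂ := (inferInstance : MeasurableVAdd U.Λ.toAddSubgroup ℂ)
  have : VAddInvariantMeasure U.Λ ℂ volume :=
    (inferInstance : VAddInvariantMeasure U.Λ.toAddSubgroup ℂ volume)
  let F := ZSpan.fundamentalDomain ((Module.Free.chooseBasis ℤ U.Λ).ofZLatticeBasis ℝ)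
  have hF : IsAddFundamentalDomain U.Λ F volume :=
    ZLattice.isAddFundamentalDomain (Module.Free.chooseBasis ℤ U.Λ) volume
  refine ⟨F, hF, ?_, fun P hP => ?_⟩
  · rw [ZLattice.covolume_eq_measure_fundamentalDomain U.Λ volume hF, ofReal_measureReal
      (Bornology.IsBounded.measure_lt_top (ZSpan.fundamentalDomain_isBounded _)).ne]
  · rw [← lintegral_indicator_one hP, hF.lintegral_eq_tsum'']
    unfold multiplicity
    rw [lintegral_tsum]
    · rfl
    · intro g
      exact ((measurable_one.indicator hP).comp (measurable_const_add _)).aemeasurable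

variable {U}

theorem sum_volume_cell (hU : G.IsRhombic U.edge) {I : Set ℝ} (hI : volume I = 1) :
    ∑ d, volume (U.cell I d) = ENNReal.ofReal (G.totalArea U.edge) := by
  rw [totalArea, ENNReal.ofReal_sum_of_nonneg fun d _ => (hU.star_mul_pos d).le]
  refine Finset.sum_congr rfl fun d _ => ?_
  rw [cell, volume_coord_preimage (hU.area_pos d) _ hI, hU.rot]

end UnitDrawing

section FaceDarts

open Classical in
variable (G) in
/-- The darts of the face to the left of `d`. -/
noncomputable def faceDarts (d : D) : Finset D := (Finset.range 4).image fun k => G.next^[k] d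

theorem card_faceDarts (d : D) : (G.faceDarts d).card = 4 := by
  classical
  rw [faceDarts, Finset.card_image_of_injOn, Finset.card_range]
  have := Function.iterate_injOn_Iio_minimalPeriod (f := G.next) (x := d)
  rw [G.face_degree] at this
  intro i hi j hj h
  exact this (by simpa using hi) (by simpa using hj) h

theorem mem_faceDarts {d d' : D} : d' ∈ G.faceDarts d ↔ G.next.SameCycle d d' := by
  classical
  rw [faceDarts, Finset.mem_image]
  constructor
  · rintro ⟨k, -, rfl⟩
    exact ⟨k, by simp [Equiv.Perm.iterate_eq_pow]⟩
  · intro h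
    obtain ⟨n, -, hn⟩ := h.exists_pow_eq'
    refine ⟨n % 4, Finset.mem_range.2 (Nat.mod_lt _ (by norm_num)), ?_⟩
    have := Function.iterate_mod_minimalPeriod_eq (f := G.next) (x := d) (n := n)
    rw [G.face_degree] at this
    rw [this, Equiv.Perm.iterate_eq_pow, hn]

theorem sameCycle_next_cases {d d' : D} (h : G.next.SameCycle d d') :
    d' = d ∨ d' = G.next d ∨ d' = G.next (G.next d) ∨ d' = G.next (G.next (G.next d)) := by
  classical
  rw [← mem_faceDarts, faceDarts, Finset.mem_image] at h
  obtain ⟨k, hk, rfl⟩ := h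
  rw [Finset.mem_range] at hk
  interval_cases k <;> simp

end FaceDarts

namespace UnitDrawing

variable {U : UnitDrawing G}

/-- The next dart of a face sees the point `(s, t)` as `(t, 1 - s)`, so any set symmetric under `r ↦
1 - r` works; open and closed intervals are both needed. -/
theorem exists_facePoint_of_mem_faceDarts (hU : G.IsRhombic U.edge) {I : Set ℝ}
    (hI : ∀ r ∈ I, 1 - r ∈ I) {d d' : D} (hd' : d' ∈ G.faceDarts d) {s t : ℝ} (hs : s ∈ I)
    (ht : t ∈ I) : ∃ s' ∈ I, ∃ t' ∈ I, U.facePoint d' s' t' = U.facePoint d s t := by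
  have step : ∀ d₁, ∀ s₁ ∈ I, ∀ t₁ ∈ I, ∃ s₂ ∈ I, ∃ t₂ ∈ I,
      U.facePoint (G.next d₁) s₂ t₂ = U.facePoint d₁ s₁ t₁ := fun d₁ s₁ hs₁ t₁ ht₁ =>
    ⟨t₁, ht₁, 1 - s₁, hI _ hs₁, by rw [facePoint_next hU, sub_sub_cancel]⟩
  classical
  rw [faceDarts, Finset.mem_image] at hd'
  obtain ⟨k, -, rfl⟩ := hd'
  induction k with
  | zero => exact ⟨s, hs, t, ht, rfl⟩
  | succ n ih =>
    obtain ⟨s', hs', t', ht', h⟩ := ih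
    rw [Function.iterate_succ_apply', ← h]
    exact step _ s' hs' t' ht'

theorem one_sub_mem_Icc (r : ℝ) (hr : r ∈ Set.Icc (0 : ℝ) 1) : 1 - r ∈ Set.Icc (0 : ℝ) 1 :=
  ⟨by linarith [hr.2], by linarith [hr.1]⟩

theorem one_sub_mem_Ioo (r : ℝ) (hr : r ∈ Set.Ioo (0 : ℝ) 1) : 1 - r ∈ Set.Ioo (0 : ℝ) 1 :=
  ⟨by linarith [hr.2], by linarith [hr.1]⟩

theorem one_le_multiplicity_faceDarts (hU : G.IsRhombic U.edge) {I : Set ℝ}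
    (hI : ∀ r ∈ I, 1 - r ∈ I) {d : D} {s t : ℝ} (hs : s ∈ I) (ht : t ∈ I) {x : ℂ}
    (h : U.facePoint d s t = (QuotientAddGroup.mk x : ℂ ⧸ U.Λ.toAddSubgroup)) :
    ∀ d' ∈ G.faceDarts d, 1 ≤ U.multiplicity (U.cell I d') x := by
  intro d' hd'
  obtain ⟨s', hs', t', ht', h'⟩ := exists_facePoint_of_mem_faceDarts hU hI hd' hs ht
  exact one_le_multiplicity_cell hU hs' ht' (h'.trans h)

/-- The faces cover the torus, and each face is listed by its four darts. -/
theorem four_le_sum_multiplicity (hU : G.IsRhombic U.edge) (x : ℂ) :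
    4 ≤ ∑ d, U.multiplicity (U.cell (Set.Icc 0 1) d) x := by
  have hx : (QuotientAddGroup.mk x : ℂ ⧸ U.Λ.toAddSubgroup) ∈ U.support := by
    rw [support_eq_univ hU]; trivial
  obtain ⟨d, s, hs, t, ht, h⟩ := hx
  have h1 := one_le_multiplicity_faceDarts hU one_sub_mem_Icc hs ht h
  calc (4 : ℝ≥0∞) = ∑ _d' ∈ G.faceDarts d, 1 := by simp [card_faceDarts]
    _ ≤ ∑ d' ∈ G.faceDarts d, U.multiplicity (U.cell (Set.Icc 0 1) d') x :=
      Finset.sum_le_sum h1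
    _ ≤ _ := Finset.sum_le_sum_of_subset (Finset.subset_univ _)

theorem covolume_nonneg (U : UnitDrawing G) : 0 ≤ ZLattice.covolume U.Λ volume :=
  ENNReal.toReal_nonneg

/-- The faces of a locally rhombic drawing have total area at least the area of the torus. -/
theorem four_mul_covolume_le (hU : G.IsRhombic U.edge) :
    4 * ZLattice.covolume U.Λ volume ≤ G.totalArea U.edge := by
  obtain ⟨F, -, hFv, hF⟩ := U.exists_fundamentalDomain
  rw [← ENNReal.ofReal_le_ofReal_iff hU.totalArea_pos.le, ENNReal.ofReal_mul (by norm_num), ← hFv,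
    ← sum_volume_cell hU (I := Set.Icc 0 1) (by simp)]
  calc ENNReal.ofReal 4 * volume F = ∫⁻ x in F, 4 := by simp
    _ ≤ ∫⁻ x in F, ∑ d, U.multiplicity (U.cell (Set.Icc 0 1) d) x :=
      lintegral_mono (four_le_sum_multiplicity hU)
    _ = ∑ d, volume (U.cell (Set.Icc 0 1) d) := by
      rw [lintegral_finsetSum _ fun d _ => U.measurable_multiplicity
        (measurableSet_cell _ measurableSet_Icc d)]
      exact Finset.sum_congr rfl fun d _ => (hF _ (measurableSet_cell _ measurableSet_Icc d)).symm

/-- If the faces have total area equal to the area of the torus, then no open set is covered more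
than once. -/
theorem exists_sum_multiplicity_eq (hU : G.IsRhombic U.edge)
    (hA : G.totalArea U.edge ≤ 4 * ZLattice.covolume U.Λ volume) {O : Set ℂ} (hO : IsOpen O)
    (hne : O.Nonempty) :
    ∃ x ∈ O, ∑ d, U.multiplicity (U.cell (Set.Icc 0 1) d) x = 4 := by
  obtain ⟨F, hFd, hFv, hF⟩ := U.exists_fundamentalDomain
  have hdisc := U.countable_lattice
  have : MeasurableVAdd U.Λ ℂ := (inferInstance : MeasurableVAdd U.Λ.toAddSubgroup ℂ)
  have : VAddInvariantMeasure U.Λ ℂ volume :=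
    (inferInstance : VAddInvariantMeasure U.Λ.toAddSubgroup ℂ volume)
  have hmeas : Measurable fun x => ∑ d, U.multiplicity (U.cell (Set.Icc 0 1) d) x :=
    Finset.measurable_fun_sum _ fun d _ => U.measurable_multiplicity
      (measurableSet_cell _ measurableSet_Icc d)
  have hint : ∫⁻ x in F, ∑ d, U.multiplicity (U.cell (Set.Icc 0 1) d) x ≤ ∫⁻ x in F, 4 := by
    rw [lintegral_finsetSum _ fun d _ => U.measurable_multiplicity
        (measurableSet_cell _ measurableSet_Icc d)]
    have : ∫⁻ x in F, (4 : ℝ≥0∞) = ENNReal.ofReal (4 * ZLattice.covolume U.Λ volume) := by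
      rw [ENNReal.ofReal_mul (by norm_num), ← hFv]; simp
    rw [this]
    refine le_trans (le_of_eq ?_) (ENNReal.ofReal_le_ofReal hA)
    rw [← sum_volume_cell hU (I := Set.Icc 0 1) (by simp)]
    exact Finset.sum_congr rfl fun d _ => (hF _ (measurableSet_cell _ measurableSet_Icc d)).symm
  have hfin : ∫⁻ x in F, (4 : ℝ≥0∞) ≠ ∞ := by
    rw [setLIntegral_const, hFv]
    exact ENNReal.mul_ne_top (by norm_num) ENNReal.ofReal_ne_top
  -- The multiplicity is at least four everywhere and has integral at most that of four, hence
  -- equals four almost everywhere.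
  have hae := ae_eq_of_ae_le_of_lintegral_le (μ := volume.restrict F)
    (f := fun _ => (4 : ℝ≥0∞)) (ae_of_all _ (four_le_sum_multiplicity hU)) hfin
    hmeas.aemeasurable hint
  let B : Set ℂ := {x | ∑ d, U.multiplicity (U.cell (Set.Icc 0 1) d) x ≠ 4}
  have hBm : MeasurableSet B := (hmeas (measurableSet_singleton 4)).compl
  have hB : volume (B ∩ F) = 0 := by
    rw [← Measure.restrict_apply hBm]
    have h2 : ∀ᵐ x ∂(volume.restrict F), x ∉ B := by
      filter_upwards [hae] with x hx
      simp only [B, Set.mem_ofPred_eq, not_not]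
      exact hx.symm
    exact measure_eq_zero_iff_ae_notMem.2 h2
  -- The exceptional set is invariant under the lattice, so being null in a fundamental domain makes
  -- it null in the plane.
  have hB0 : volume B = 0 := by
    refine hFd.measure_zero_of_invariant B (fun g => ?_) hB
    ext x
    rw [Set.mem_vadd_set_iff_neg_vadd_mem]
    have h3 : ∀ P : Set ℂ, U.multiplicity P (-g +ᵥ x) = U.multiplicity P x := fun P =>
      multiplicity_add P (-g) x
    simp only [B, Set.mem_ofPred_eq, h3]
  by_contra hcon
  push Not at hcon
  have : O ⊆ B := hcon
  exact (hO.measure_pos volume hne).ne' (measure_mono_null this hB0)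

/-- Two interior lifts of one point in the same cell persist on an open set, where one dart counts
twice and the other three of its face once: five instead of four. -/
theorem face_injective_of_area (hU : G.IsRhombic U.edge)
    (hA : G.totalArea U.edge ≤ 4 * ZLattice.covolume U.Λ volume) (d : D)
    {s t s' t' : ℝ} (hs : s ∈ Set.Ioo (0 : ℝ) 1) (ht : t ∈ Set.Ioo (0 : ℝ) 1)
    (hs' : s' ∈ Set.Ioo (0 : ℝ) 1) (ht' : t' ∈ Set.Ioo (0 : ℝ) 1)
    (h : U.facePoint d s t = U.facePoint d s' t') : s = s' ∧ t = t' := by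
  classical
  by_contra hne
  obtain ⟨h1, h2⟩ := mk_facePoint hU _ d hs ht
  obtain ⟨h1', h2'⟩ := mk_facePoint hU _ d hs' ht'
  set z := U.lift d + ((s : ℂ) * U.edge d + (t : ℂ) * U.edge (G.rot d)) with hz
  set z' := U.lift d + ((s' : ℂ) * U.edge d + (t' : ℂ) * U.edge (G.rot d)) with hz'
  have hzz : z ≠ z' := by
    intro heq
    have h3 := add_left_cancel (hz.symm.trans (heq.trans hz'))
    have hx := congrArg (coordX (U.edge d) (U.edge (G.rot d))) h3
    have hy := congrArg (coordY (U.edge d) (U.edge (G.rot d))) h3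
    rw [coordX_combination (hU.area_pos d).ne', coordX_combination (hU.area_pos d).ne'] at hx
    rw [coordY_combination (hU.area_pos d).ne', coordY_combination (hU.area_pos d).ne'] at hy
    exact hne ⟨hx, hy⟩
  rw [← h2, ← h2', mk_eq_mk_iff] at h
  let O : Set ℂ := U.cell (Set.Ioo 0 1) d ∩ (fun x => (z' - z) + x) ⁻¹' U.cell (Set.Ioo 0 1) d
  have hO : IsOpen O := (isOpen_cell d).inter ((isOpen_cell d).preimage (by fun_prop))
  obtain ⟨x, hx, hx4⟩ := exists_sum_multiplicity_eq hU hA hO ⟨z, h1, by simpa using h1'⟩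
  have hsub : U.cell (Set.Ioo 0 1) d ⊆ U.cell (Set.Icc 0 1) d := fun w hw =>
    ⟨Set.Ioo_subset_Icc_self hw.1, Set.Ioo_subset_Icc_self hw.2⟩
  have htwo : 2 ≤ U.multiplicity (U.cell (Set.Icc 0 1) d) x := by
    refine two_le_multiplicity (g := 0) (g' := ⟨z' - z, h⟩) ?_ (by simpa using hsub hx.1)
      (hsub hx.2)
    intro h0
    have := congrArg Subtype.val h0
    exact hzz (sub_eq_zero.1 this.symm).symm
  have hone := one_le_multiplicity_faceDarts hU one_sub_mem_Icc (hsub hx.1).1 (hsub hx.1).2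
    (mk_eq_facePoint hU d x).symm
  have hmem : d ∈ G.faceDarts d := mem_faceDarts.2 (Equiv.Perm.SameCycle.refl _ _)
  have h5 : (5 : ℝ≥0∞) ≤ ∑ d, U.multiplicity (U.cell (Set.Icc 0 1) d) x := by
    calc (5 : ℝ≥0∞) = 2 + ∑ _d' ∈ (G.faceDarts d).erase d, 1 := by
          simp [Finset.card_erase_of_mem hmem, card_faceDarts]; norm_num
      _ ≤ U.multiplicity (U.cell (Set.Icc 0 1) d) x
          + ∑ d' ∈ (G.faceDarts d).erase d, U.multiplicity (U.cell (Set.Icc 0 1) d') x :=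
        add_le_add htwo (Finset.sum_le_sum fun d' hd' => hone d' (Finset.mem_of_mem_erase hd'))
      _ = ∑ d' ∈ G.faceDarts d, U.multiplicity (U.cell (Set.Icc 0 1) d') x :=
        Finset.add_sum_erase _ (fun d' => U.multiplicity (U.cell (Set.Icc 0 1) d') x) hmem
      _ ≤ _ := Finset.sum_le_sum_of_subset (Finset.subset_univ _)
  rw [hx4] at h5
  norm_num at h5

/-- An overlap of open faces is open; there the four darts of one face and a dart of the other give
multiplicity at least five. -/
theorem face_disjoint_of_area (hU : G.IsRhombic U.edge)
    (hA : G.totalArea U.edge ≤ 4 * ZLattice.covolume U.Λ volume) {d d' : D}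
    (hd : ¬G.next.SameCycle d d') {s t s' t' : ℝ} (hs : s ∈ Set.Ioo (0 : ℝ) 1)
    (ht : t ∈ Set.Ioo (0 : ℝ) 1) (hs' : s' ∈ Set.Ioo (0 : ℝ) 1) (ht' : t' ∈ Set.Ioo (0 : ℝ) 1) :
    U.facePoint d s t ≠ U.facePoint d' s' t' := by
  classical
  intro h
  obtain ⟨h1, h2⟩ := mk_facePoint hU _ d hs ht
  obtain ⟨h1', h2'⟩ := mk_facePoint hU _ d' hs' ht'
  set z := U.lift d + ((s : ℂ) * U.edge d + (t : ℂ) * U.edge (G.rot d)) with hz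
  set z' := U.lift d' + ((s' : ℂ) * U.edge d' + (t' : ℂ) * U.edge (G.rot d')) with hz'
  rw [← h2, ← h2', mk_eq_mk_iff] at h
  let O : Set ℂ := U.cell (Set.Ioo 0 1) d ∩ (fun x => (z' - z) + x) ⁻¹' U.cell (Set.Ioo 0 1) d'
  have hO : IsOpen O := (isOpen_cell d).inter ((isOpen_cell d').preimage (by fun_prop))
  obtain ⟨x, hx, hx4⟩ := exists_sum_multiplicity_eq hU hA hO ⟨z, h1, by simpa using h1'⟩
  have hsub : ∀ d, U.cell (Set.Ioo 0 1) d ⊆ U.cell (Set.Icc 0 1) d := fun d w hw =>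
    ⟨Set.Ioo_subset_Icc_self hw.1, Set.Ioo_subset_Icc_self hw.2⟩
  have hone' : 1 ≤ U.multiplicity (U.cell (Set.Icc 0 1) d') x :=
    one_le_multiplicity ⟨z' - z, h⟩ (hsub _ hx.2)
  have hone := one_le_multiplicity_faceDarts hU one_sub_mem_Icc (hsub _ hx.1).1 (hsub _ hx.1).2
    (mk_eq_facePoint hU d x).symm
  have hmem : d' ∉ G.faceDarts d := fun hm => hd (mem_faceDarts.1 hm)
  have h5 : (5 : ℝ≥0∞) ≤ ∑ d, U.multiplicity (U.cell (Set.Icc 0 1) d) x := by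
    calc (5 : ℝ≥0∞) = 1 + ∑ _d' ∈ G.faceDarts d, 1 := by
          simp [card_faceDarts]; norm_num
      _ ≤ U.multiplicity (U.cell (Set.Icc 0 1) d') x
          + ∑ d' ∈ G.faceDarts d, U.multiplicity (U.cell (Set.Icc 0 1) d') x :=
        add_le_add hone' (Finset.sum_le_sum hone)
      _ = ∑ d' ∈ insert d' (G.faceDarts d), U.multiplicity (U.cell (Set.Icc 0 1) d') x :=
        (Finset.sum_insert (f := fun d' => U.multiplicity (U.cell (Set.Icc 0 1) d') x) hmem).symm
      _ ≤ _ := Finset.sum_le_sum_of_subset (Finset.subset_univ _)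
  rw [hx4] at h5
  norm_num at h5

end UnitDrawing

/-- The faces of a rhombic embedding have total area at most the area of the torus. -/
theorem RhombicEmbedding.totalArea_le (R : RhombicEmbedding G) :
    G.totalArea R.edge ≤ 4 * ZLattice.covolume R.Λ volume := by
  classical
  have hU := R.isRhombic
  obtain ⟨F, -, hFv, hF⟩ := R.toUnitDrawing.exists_fundamentalDomain
  rw [← ENNReal.ofReal_le_ofReal_iff (mul_nonneg (by norm_num) R.toUnitDrawing.covolume_nonneg),
    ENNReal.ofReal_mul (by norm_num), ← hFv,
    ← UnitDrawing.sum_volume_cell hU (I := Set.Ioo 0 1) (by simp)]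
  have hle1 : ∀ d x, R.multiplicity (R.cell (Set.Ioo 0 1) d) x ≤ 1 := by
    intro d x
    by_cases hex : ∃ g : R.Λ, (g : ℂ) + x ∈ R.cell (Set.Ioo 0 1) d
    · obtain ⟨g, hg⟩ := hex
      rw [UnitDrawing.multiplicity, tsum_eq_single g]
      · exact Set.indicator_le_self' (by simp) _
      · intro g' hg'
        refine Set.indicator_of_notMem (fun hmem => hg' ?_) _
        have e1 := UnitDrawing.mk_eq_facePoint hU d ((g : ℂ) + x)
        have e2 := UnitDrawing.mk_eq_facePoint hU d ((g' : ℂ) + x)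
        have e3 : (QuotientAddGroup.mk ((g : ℂ) + x) : ℂ ⧸ R.Λ.toAddSubgroup)
            = QuotientAddGroup.mk ((g' : ℂ) + x) := by
          rw [UnitDrawing.mk_eq_mk_iff, add_sub_add_right_eq_sub]
          exact R.Λ.sub_mem g'.2 g.2
        obtain ⟨hx, hy⟩ := R.face_injective d _ hg.1 _ hg.2 _ hmem.1 _ hmem.2
          (e1.symm.trans (e3.trans e2))
        have c1 := coordX_mul_add (hU.area_pos d).ne' ((g : ℂ) + x - R.lift d)
        have c2 := coordX_mul_add (hU.area_pos d).ne' ((g' : ℂ) + x - R.lift d)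
        rw [hx, hy, c2] at c1
        exact Subtype.ext (add_right_cancel (sub_left_injective c1))
    · push Not at hex
      rw [UnitDrawing.multiplicity]
      simp [Set.indicator_of_notMem (hex _)]
  have hle : ∀ x, ∑ d, R.multiplicity (R.cell (Set.Ioo 0 1) d) x ≤ 4 := by
    intro x
    by_cases hex : ∃ d, ∃ g : R.Λ, (g : ℂ) + x ∈ R.cell (Set.Ioo 0 1) d
    · obtain ⟨d, g, hg⟩ := hex
      have hzero : ∀ d', d' ∉ G.faceDarts d → R.multiplicity (R.cell (Set.Ioo 0 1) d') x = 0 := by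
        intro d' hd'
        rw [UnitDrawing.multiplicity, ENNReal.tsum_eq_zero]
        intro g'
        refine Set.indicator_of_notMem (fun hmem => ?_) _
        have e1 := UnitDrawing.mk_eq_facePoint hU d ((g : ℂ) + x)
        have e2 := UnitDrawing.mk_eq_facePoint hU d' ((g' : ℂ) + x)
        have e3 : (QuotientAddGroup.mk ((g : ℂ) + x) : ℂ ⧸ R.Λ.toAddSubgroup)
            = QuotientAddGroup.mk ((g' : ℂ) + x) := by
          rw [UnitDrawing.mk_eq_mk_iff, add_sub_add_right_eq_sub]
          exact R.Λ.sub_mem g'.2 g.2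
        exact R.face_disjoint d d' (fun h => hd' (mem_faceDarts.2 h)) _ hg.1 _ hg.2 _ hmem.1 _
          hmem.2 (e1.symm.trans (e3.trans e2))
      calc ∑ d, R.multiplicity (R.cell (Set.Ioo 0 1) d) x
          = ∑ d' ∈ G.faceDarts d, R.multiplicity (R.cell (Set.Ioo 0 1) d') x :=
            (Finset.sum_subset (Finset.subset_univ _) fun d' _ hd' => hzero d' hd').symm
        _ ≤ ∑ _d' ∈ G.faceDarts d, 1 := Finset.sum_le_sum fun d' _ => hle1 d' x
        _ = 4 := by simp [card_faceDarts]
    · push Not at hex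
      simp [UnitDrawing.multiplicity, Set.indicator_of_notMem (hex _ _)]
  calc ∑ d, volume (R.cell (Set.Ioo 0 1) d)
      = ∫⁻ x in F, ∑ d, R.multiplicity (R.cell (Set.Ioo 0 1) d) x := by
        rw [lintegral_finsetSum _ fun d _ => R.measurable_multiplicity
          (UnitDrawing.measurableSet_cell _ measurableSet_Ioo d)]
        exact Finset.sum_congr rfl fun d _ =>
          hF _ (UnitDrawing.measurableSet_cell _ measurableSet_Ioo d)
    _ ≤ ∫⁻ x in F, 4 := lintegral_mono hle
    _ = ENNReal.ofReal 4 * volume F := by simp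

/-- Covering gives one inequality and disjointness of the open faces the other. -/
theorem RhombicEmbedding.four_mul_area (R : RhombicEmbedding G) :
    4 * R.area = G.totalArea R.edge :=
  le_antisymm (UnitDrawing.four_mul_covolume_le R.isRhombic) R.totalArea_le

end TorusQuadrangulation

namespace TorusQuadrangulation

open Topology MeasureTheory Filter

variable {D : Type*} [Fintype D] {G : TorusQuadrangulation D}

/-! ### From disjoint faces to an embedding -/

theorem eventually_add_mul_mem_Ioo {s X : ℝ} (hs : s ∈ Set.Ico (0 : ℝ) 1) (hX : s = 0 → 0 < X) :
    ∀ᶠ ε in 𝓝[>] (0 : ℝ), s + ε * X ∈ Set.Ioo (0 : ℝ) 1 := by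
  have hlim : Tendsto (fun ε : ℝ => s + ε * X) (𝓝 0) (𝓝 s) := by
    have : Continuous fun ε : ℝ => s + ε * X := by fun_prop
    simpa using this.tendsto 0
  have h1 : ∀ᶠ ε in 𝓝[>] (0 : ℝ), s + ε * X < 1 :=
    (hlim.eventually (gt_mem_nhds hs.2)).filter_mono nhdsWithin_le_nhds
  rcases eq_or_lt_of_le hs.1 with rfl | h0
  · filter_upwards [h1, self_mem_nhdsWithin] with ε hε hpos
    exact ⟨by simpa using mul_pos hpos (hX rfl), hε⟩
  · filter_upwards [h1, (hlim.eventually (lt_mem_nhds h0)).filter_mono nhdsWithin_le_nhds]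
      with ε hε hpos
    exact ⟨hpos, hε⟩

theorem tendsto_add_mul_zero (s X : ℝ) :
    Tendsto (fun ε : ℝ => s + ε * X) (𝓝[>] 0) (𝓝 s) := by
  have : Continuous fun ε : ℝ => s + ε * X := by fun_prop
  have h := this.tendsto 0
  simp only [zero_mul, add_zero] at h
  exact h.mono_left nhdsWithin_le_nhds

namespace UnitDrawing

variable {U : UnitDrawing G}

/-- If the open faces are embedded and disjoint, then two half-open edges meet in a point at which
the faces on their left have a common tangent direction only if they agree. -/
theorem eq_of_common_tangent (hU : G.IsRhombic U.edge)
    (hA : G.totalArea U.edge ≤ 4 * ZLattice.covolume U.Λ volume) {d d' : D} {s s' : ℝ}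
    (hs : s ∈ Set.Ico (0 : ℝ) 1) (hs' : s' ∈ Set.Ico (0 : ℝ) 1)
    (h : U.edgePoint d s = U.edgePoint d' s') {w : ℂ}
    (hY : 0 < coordY (U.edge d) (U.edge (G.rot d)) w)
    (hY' : 0 < coordY (U.edge d') (U.edge (G.rot d')) w)
    (hX : s = 0 → 0 < coordX (U.edge d) (U.edge (G.rot d)) w)
    (hX' : s' = 0 → 0 < coordX (U.edge d') (U.edge (G.rot d')) w) : d' = d ∧ s' = s := by
  set X := coordX (U.edge d) (U.edge (G.rot d)) w with hXdef
  set Y := coordY (U.edge d) (U.edge (G.rot d)) w with hYdef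
  set X' := coordX (U.edge d') (U.edge (G.rot d')) w with hXdef'
  set Y' := coordY (U.edge d') (U.edge (G.rot d')) w with hYdef'
  have hev : ∀ᶠ ε in 𝓝[>] (0 : ℝ), (s + ε * X ∈ Set.Ioo (0 : ℝ) 1 ∧ 0 + ε * Y ∈ Set.Ioo (0 : ℝ) 1)
      ∧ (s' + ε * X' ∈ Set.Ioo (0 : ℝ) 1 ∧ 0 + ε * Y' ∈ Set.Ioo (0 : ℝ) 1) :=
    ((eventually_add_mul_mem_Ioo hs hX).and (eventually_add_mul_mem_Ioo (by simp) fun _ => hY)).and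
      ((eventually_add_mul_mem_Ioo hs' hX').and
        (eventually_add_mul_mem_Ioo (by simp) fun _ => hY'))
  have heq : ∀ ε : ℝ, U.facePoint d (s + ε * X) (0 + ε * Y)
      = U.facePoint d' (s' + ε * X') (0 + ε * Y') := by
    intro ε
    have h1 := edgePoint_add hU d s (ε * w)
    have h2 := edgePoint_add hU d' s' (ε * w)
    rw [coordX_real_mul, coordY_real_mul] at h1 h2
    rw [zero_add, zero_add, ← h1, ← h2, h]
  have hsc : G.next.SameCycle d d' := by
    obtain ⟨ε, ⟨⟨a1, a2⟩, a3, a4⟩⟩ := hev.exists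
    by_contra hcon
    exact face_disjoint_of_area hU hA hcon a1 a2 a3 a4 (heq ε)
  -- Points displaced by `ε * w` lie in both open faces, so the faces coincide. For a different
  -- dart, equal coordinates in the limit `ε → 0` give `s = 1`, `0 = 1` or `s' = 1`; the first and
  -- the last are excluded because the edges are half-open.
  rcases sameCycle_next_cases hsc with rfl | hd | hd | hd
  · obtain ⟨ε, ⟨⟨a1, a2⟩, a3, a4⟩⟩ := hev.exists
    have := (face_injective_of_area hU hA _ a1 a2 a3 a4 (heq ε)).1
    exact ⟨rfl, by linarith⟩
  · exfalso
    have : ∀ᶠ ε in 𝓝[>] (0 : ℝ), s + ε * X = 1 + ε * (-Y') := by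
      filter_upwards [hev] with ε hε
      obtain ⟨⟨a1, a2⟩, a3, a4⟩ := hε
      have := heq ε
      rw [hd, facePoint_next hU] at this
      have := (face_injective_of_area hU hA _ a1 a2 (one_sub_mem_Ioo _ a4) a3 this).1
      linarith
    have := tendsto_nhds_unique ((tendsto_add_mul_zero s X).congr' this)
      (tendsto_add_mul_zero 1 (-Y'))
    linarith [hs.2]
  · exfalso
    have : ∀ᶠ ε in 𝓝[>] (0 : ℝ), 0 + ε * Y = 1 + ε * (-Y') := by
      filter_upwards [hev] with ε hε
      obtain ⟨⟨a1, a2⟩, a3, a4⟩ := hε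
      have := heq ε
      rw [hd, facePoint_next hU, facePoint_next hU] at this
      have := (face_injective_of_area hU hA _ a1 a2 (one_sub_mem_Ioo _ a3) (one_sub_mem_Ioo _ a4)
        this).2
      linarith
    have := tendsto_nhds_unique ((tendsto_add_mul_zero 0 Y).congr' this)
      (tendsto_add_mul_zero 1 (-Y'))
    linarith
  · exfalso
    have : ∀ᶠ ε in 𝓝[>] (0 : ℝ), 0 + ε * Y = (1 - s') + ε * (-X') := by
      filter_upwards [hev] with ε hε
      obtain ⟨⟨a1, a2⟩, a3, a4⟩ := hε
      have := heq ε
      rw [hd, facePoint_next hU, facePoint_next hU, facePoint_next hU, sub_sub_cancel] at this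
      have := (face_injective_of_area hU hA _ a1 a2 a4 (one_sub_mem_Ioo _ a3) this).2
      linarith
    have := tendsto_nhds_unique ((tendsto_add_mul_zero 0 Y).congr' this)
      (tendsto_add_mul_zero (1 - s') (-X'))
    linarith [hs'.2]

/-- Every tangent direction of a face can be perturbed into the interior of a wedge of a given
vertex. -/
theorem exists_tangent_wedge (hU : G.IsRhombic U.edge) (d d' : D) {w : ℂ} {p : Prop}
    (hY : 0 < coordY (U.edge d) (U.edge (G.rot d)) w)
    (hX : p → 0 < coordX (U.edge d) (U.edge (G.rot d)) w) :
    ∃ d₁, G.tail d₁ = G.tail d' ∧ ∃ w', 0 < coordY (U.edge d) (U.edge (G.rot d)) w' ∧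
      (p → 0 < coordX (U.edge d) (U.edge (G.rot d)) w') ∧
      0 < coordX (U.edge d₁) (U.edge (G.rot d₁)) w' ∧
      0 < coordY (U.edge d₁) (U.edge (G.rot d₁)) w' := by
  obtain ⟨d₁, hd₁, hx, hy⟩ := hU.exists_cone w d'
  -- A small multiple of this diagonal pushes `w` off the boundary of the closed wedge. The
  -- proposition `p` switches on the second inequality, which is needed only when the point is a
  -- vertex.
  set u := U.edge d₁ + U.edge (G.rot d₁) with hu
  have hu' : u = ((1 : ℝ) : ℂ) * U.edge d₁ + ((1 : ℝ) : ℂ) * U.edge (G.rot d₁) := by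
    simp [hu]
  have hux : coordX (U.edge d₁) (U.edge (G.rot d₁)) u = 1 := by
    rw [hu', coordX_combination (hU.area_pos _).ne']
  have huy : coordY (U.edge d₁) (U.edge (G.rot d₁)) u = 1 := by
    rw [hu', coordY_combination (hU.area_pos _).ne']
  have hev : ∀ᶠ ε in 𝓝[>] (0 : ℝ), 0 < coordY (U.edge d) (U.edge (G.rot d)) w
        + ε * coordY (U.edge d) (U.edge (G.rot d)) u ∧
      (p → 0 < coordX (U.edge d) (U.edge (G.rot d)) w
        + ε * coordX (U.edge d) (U.edge (G.rot d)) u) ∧ 0 < ε := by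
    refine Eventually.and ?_ (Eventually.and ?_ self_mem_nhdsWithin)
    · exact (tendsto_add_mul_zero _ _).eventually (lt_mem_nhds hY)
    · by_cases hp : p
      · filter_upwards [(tendsto_add_mul_zero _
          (coordX (U.edge d) (U.edge (G.rot d)) u)).eventually (lt_mem_nhds (hX hp))] with ε hε
        exact fun _ => hε
      · exact Eventually.of_forall fun _ h => absurd h hp
  obtain ⟨ε, h1, h2, h3⟩ := hev.exists
  refine ⟨d₁, hd₁, w + ε * u, ?_⟩
  simp only [coordX_add, coordY_add, coordX_real_mul, coordY_real_mul, hux, huy]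
  exact ⟨h1, h2, by linarith, by linarith⟩

/-- If two vertices coincided, an interior direction of a wedge at one would lie inside a wedge at
the other, after perturbation. -/
theorem pos_injective_of_area (hU : G.IsRhombic U.edge)
    (hA : G.totalArea U.edge ≤ 4 * ZLattice.covolume U.Λ volume) : Function.Injective U.pos := by
  intro v v' h
  induction v using Quotient.inductionOn with | h d => ?_
  induction v' using Quotient.inductionOn with | h d' => ?_
  change G.tail d = G.tail d'
  change U.pos (G.tail d) = U.pos (G.tail d') at h
  have hw : U.edge d + U.edge (G.rot d)
      = ((1 : ℝ) : ℂ) * U.edge d + ((1 : ℝ) : ℂ) * U.edge (G.rot d) := by simp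
  obtain ⟨d₁, hd₁, w, h1, h2, h3, h4⟩ := exists_tangent_wedge hU d d' (p := True)
    (w := U.edge d + U.edge (G.rot d))
    (by rw [hw, coordY_combination (hU.area_pos _).ne']; exact one_pos)
    (by rw [hw, coordX_combination (hU.area_pos _).ne']; exact fun _ => one_pos)
  rw [← hd₁, ← edgePoint_zero, ← edgePoint_zero] at h
  have := eq_of_common_tangent hU hA (by simp) (by simp) h h1 h4 (fun _ => h2 trivial) fun _ => h3
  rw [← hd₁, this.1]

theorem edge_rot_coordY (hU : G.IsRhombic U.edge) (d : D) :
    coordY (U.edge d) (U.edge (G.rot d)) (U.edge (G.rot d)) = 1 :=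
  div_self (hU.area_pos d).ne'

theorem edge_vertex_of_area (hU : G.IsRhombic U.edge)
    (hA : G.totalArea U.edge ≤ 4 * ZLattice.covolume U.Λ volume) (d : D) (v : G.Vertex) {s : ℝ}
    (hs : s ∈ Set.Ioo (0 : ℝ) 1) : U.edgePoint d s ≠ U.pos v := by
  intro h
  induction v using Quotient.inductionOn with | h d' => ?_
  change U.edgePoint d s = U.pos (G.tail d') at h
  obtain ⟨d₁, hd₁, w, h1, h2, h3, h4⟩ := exists_tangent_wedge hU d d' (p := False)
    (w := U.edge (G.rot d)) (by rw [edge_rot_coordY hU]; exact one_pos) False.elim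
  rw [← hd₁, ← edgePoint_zero] at h
  have := eq_of_common_tangent hU hA ⟨hs.1.le, hs.2⟩ (by simp) h h1 h4
    (fun h0 => absurd h0 hs.1.ne') fun _ => h3
  exact hs.1.ne this.2

theorem edge_edge_of_area (hU : G.IsRhombic U.edge)
    (hA : G.totalArea U.edge ≤ 4 * ZLattice.covolume U.Λ volume) (d d' : D) {s s' : ℝ}
    (hs : s ∈ Set.Ioo (0 : ℝ) 1) (hs' : s' ∈ Set.Ioo (0 : ℝ) 1)
    (h : U.edgePoint d s = U.edgePoint d' s') :
    (d' = d ∧ s' = s) ∨ (d' = G.rev d ∧ s' = 1 - s) := by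
  -- A direction to the left of `d` and transverse to `d'`; its side relative to `d'` decides
  -- between `d'` and its reversal.
  obtain ⟨w, hw, hw'⟩ : ∃ w, 0 < coordY (U.edge d) (U.edge (G.rot d)) w ∧
      (star (U.edge d') * w).im ≠ 0 := by
    by_cases h0 : (star (U.edge d') * U.edge (G.rot d)).im = 0
    · have hlim := tendsto_add_mul_zero (coordY (U.edge d) (U.edge (G.rot d)) (U.edge (G.rot d)))
        (coordY (U.edge d) (U.edge (G.rot d)) (Complex.I * U.edge d'))
      rw [edge_rot_coordY hU] at hlim
      obtain ⟨ε, h1, h2⟩ := ((hlim.eventually (lt_mem_nhds one_pos)).and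
        self_mem_nhdsWithin).exists
      refine ⟨U.edge (G.rot d) + ε * (Complex.I * U.edge d'), ?_, ?_⟩
      · rw [coordY_add, coordY_real_mul, edge_rot_coordY hU]
        exact h1
      · have h3 : star (U.edge d') * (Complex.I * U.edge d') = Complex.I := by
          have := Complex.normSq_eq_conj_mul_self (z := U.edge d')
          rw [Complex.normSq_eq_norm_sq, U.norm_edge] at this
          rw [mul_left_comm, Complex.star_def, ← this]
          simp
        rw [mul_add, Complex.add_im, h0, mul_left_comm, h3, zero_add]
        simpa using ne_of_gt h2
    · exact ⟨_, by rw [edge_rot_coordY hU]; exact one_pos, h0⟩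
  rcases lt_or_gt_of_ne hw' with hneg | hpos
  · right
    have hY' : 0 < coordY (U.edge (G.rev d')) (U.edge (G.rot (G.rev d'))) w := by
      refine div_pos ?_ (hU.area_pos _)
      rw [U.edge_rev, star_neg, neg_mul, Complex.neg_im]
      linarith
    have h' : U.edgePoint d s = U.edgePoint (G.rev d') (1 - s') := by
      rw [h, edgePoint_rev, sub_sub_cancel]
    obtain ⟨h1, h2⟩ := eq_of_common_tangent hU hA ⟨hs.1.le, hs.2⟩
      ⟨by linarith [hs'.2], by linarith [hs'.1]⟩ h' hw hY' (fun h0 => absurd h0 hs.1.ne')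
      fun h0 => absurd h0 (by linarith [hs'.2])
    exact ⟨by rw [← h1, G.rev_rev], by linarith⟩
  · left
    exact eq_of_common_tangent hU hA ⟨hs.1.le, hs.2⟩ ⟨hs'.1.le, hs'.2⟩ h hw
      (div_pos hpos (hU.area_pos _)) (fun h0 => absurd h0 hs.1.ne') fun h0 => absurd h0 hs'.1.ne'

/-- A locally rhombic drawing whose faces have the area of the torus is a rhombic embedding. -/
def toRhombicEmbedding (U : UnitDrawing G) (hU : G.IsRhombic U.edge)
    (hA : G.totalArea U.edge ≤ 4 * ZLattice.covolume U.Λ volume) : RhombicEmbedding G where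
  toUnitDrawing := U
  pos_injective := pos_injective_of_area hU hA
  edge_vertex := fun d v _ hs => edge_vertex_of_area hU hA d v hs
  edge_edge := fun d d' _ hs _ hs' h => edge_edge_of_area hU hA d d' hs hs' h
  face_closed := hU.opp
  face_pos := hU.pos
  face_injective := fun d _ hs _ ht _ hs' _ ht' h =>
    face_injective_of_area hU hA d hs ht hs' ht' h
  face_disjoint := fun _ _ hd _ hs _ ht _ hs' _ ht' =>
    face_disjoint_of_area hU hA hd hs ht hs' ht'
  face_cover := fun x => by
    have : x ∈ U.support := by rw [support_eq_univ hU]; trivial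
    exact this

end UnitDrawing

/-! ### Realization of rhombic cocycles by deforming the torus -/

section Deformation

/-- The real-linear automorphism `z ↦ a * z + b * conj z` of the plane. -/
noncomputable def realLinearEquiv (a b : ℂ) (h : Complex.normSq a - Complex.normSq b ≠ 0) :
    ℂ ≃ₗ[ℝ] ℂ where
  toFun z := a * z + b * star z
  invFun z := (star a * z - b * star z) / (Complex.normSq a - Complex.normSq b : ℝ)
  map_add' z w := by simp; ring
  map_smul' r z := by simp; ring
  left_inv z := by
    have h' : ((Complex.normSq a - Complex.normSq b : ℝ) : ℂ) ≠ 0 := by exact_mod_cast h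
    rw [div_eq_iff h']
    push_cast [Complex.normSq_eq_conj_mul_self]
    simp
    ring
  right_inv z := by
    have h' : ((Complex.normSq a - Complex.normSq b : ℝ) : ℂ) ≠ 0 := by exact_mod_cast h
    have hs : star ((star a * z - b * star z) / ((Complex.normSq a - Complex.normSq b : ℝ) : ℂ))
        = (a * star z - star b * z) / ((Complex.normSq a - Complex.normSq b : ℝ) : ℂ) := by
      simp
    beta_reduce
    rw [hs, ← mul_div_assoc, ← mul_div_assoc, ← add_div, div_eq_iff h']
    push_cast [Complex.normSq_eq_conj_mul_self]
    simp
    ring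

theorem det_realLinearEquiv_symm (a b : ℂ) (h : Complex.normSq a - Complex.normSq b ≠ 0) :
    LinearMap.det ((realLinearEquiv a b h).symm : ℂ →ₗ[ℝ] ℂ)
      = (Complex.normSq a - Complex.normSq b)⁻¹ := by
  have hf : ((realLinearEquiv a b h) : ℂ →ₗ[ℝ] ℂ).det = Complex.normSq a - Complex.normSq b := by
    rw [← LinearMap.det_toMatrix Complex.basisOneI, Matrix.det_fin_two]
    simp [LinearMap.toMatrix_apply, realLinearEquiv, Complex.normSq_apply]
    ring
  have h1 := LinearEquiv.det_symm_mul_det (realLinearEquiv a b h)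
  rw [hf] at h1
  exact eq_inv_of_mul_eq_one_left h1

theorem covolume_comap_equiv (Λ : Submodule ℤ ℂ) [DiscreteTopology Λ] [IsZLattice ℝ Λ]
    (f : ℂ ≃L[ℝ] ℂ) :
    ZLattice.covolume (ZLattice.comap ℝ Λ f.toLinearMap) volume
      = |(LinearMap.det (f : ℂ →ₗ[ℝ] ℂ))⁻¹| * ZLattice.covolume Λ volume := by
  let μ : Measure ℂ := Measure.map f volume
  have : μ.IsAddHaarMeasure := f.isAddHaarMeasure_map volume
  have hmp : MeasurePreserving f volume μ := ⟨f.continuous.measurable, rfl⟩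
  rw [ZLattice.covolume_comap Λ (μ := μ) volume hmp]
  let b := Module.Free.chooseBasis ℤ Λ
  rw [ZLattice.covolume_eq_measure_fundamentalDomain Λ μ (ZLattice.isAddFundamentalDomain b μ),
    ZLattice.covolume_eq_measure_fundamentalDomain Λ volume
      (ZLattice.isAddFundamentalDomain b volume)]
  have hdet : LinearMap.det (f : ℂ →ₗ[ℝ] ℂ) ≠ 0 := (LinearEquiv.isUnit_det' f.toLinearEquiv).ne_zero
  have key := Measure.addHaar_preimage_linearMap volume hdet
    (ZSpan.fundamentalDomain (b.ofZLatticeBasis ℝ))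
  rw [measureReal_def, measureReal_def, Measure.map_apply f.continuous.measurable
    (ZSpan.fundamentalDomain_measurableSet _)]
  change (volume ((f : ℂ →ₗ[ℝ] ℂ) ⁻¹' _)).toReal = _
  rw [key, ENNReal.toReal_mul, ENNReal.toReal_ofReal (abs_nonneg _)]

/-- On a graph with a rhombic embedding, every rhombic cocycle is realized by a rhombic
embedding. -/
theorem RhombicEmbedding.exists_edge_eq (R : RhombicEmbedding G) {e : D → ℂ}
    (he : G.IsRhombic e) : ∃ R' : RhombicEmbedding G, R'.edge = e := by
  obtain ⟨a, b, g, h⟩ := R.isRhombic.exists_combination he.1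
  have htot := totalArea_combination R.isRhombic.1 he.1 h
  have hdet : 0 < Complex.normSq a - Complex.normSq b := by
    have p1 := he.totalArea_pos
    rw [htot] at p1
    exact (mul_pos_iff_of_pos_right R.isRhombic.totalArea_pos).1 p1
  have := R.discrete
  have := R.lattice
  let L := realLinearEquiv a b hdet.ne'
  have hL : ∀ z, L z = a * z + b * star z := fun z => rfl
  let f : ℂ ≃L[ℝ] ℂ := L.symm.toContinuousLinearEquiv
  let Λ' : Submodule ℤ ℂ := ZLattice.comap ℝ R.Λ f.toLinearMap
  have hmem : ∀ z, z ∈ R.Λ → L z ∈ Λ' := by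
    intro z hz
    change L.symm (L z) ∈ R.Λ
    rwa [L.symm_apply_apply]
  let U : UnitDrawing G :=
    { Λ := Λ'
      discrete := inferInstanceAs (DiscreteTopology (ZLattice.comap ℝ R.Λ f.toLinearMap))
      lattice := inferInstanceAs (IsZLattice ℝ (ZLattice.comap ℝ R.Λ f.toLinearEquiv.toLinearMap))
      -- The linear part accounts for `a • e + b • star e` and the shift by `g` for the coboundary.
      -- The arbitrary lifts by `out` matter only modulo the new lattice, the image of `R.Λ` under
      -- `L`.
      pos := fun v => QuotientAddGroup.mk (L (R.pos v).out + g v)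
      edge := e
      norm_edge := he.norm
      edge_rev := he.rev
      pos_head := fun d => by
        rw [← QuotientAddGroup.mk_add, QuotientAddGroup.eq]
        change _ ∈ Λ'
        have h1 : (QuotientAddGroup.mk ((R.pos (G.tail (G.rev d))).out) : ℂ ⧸ R.Λ.toAddSubgroup)
            = QuotientAddGroup.mk ((R.pos (G.tail d)).out + R.edge d) := by
          rw [QuotientAddGroup.mk_add, QuotientAddGroup.out_eq', QuotientAddGroup.out_eq',
            R.pos_head]
        rw [UnitDrawing.mk_eq_mk_iff] at h1
        have h2 := hmem _ h1
        have h3 : e d = L (R.edge d) + (g (G.tail (G.rev d)) - g (G.tail d)) := by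
          rw [h]; simp [hL, coboundary]
        rw [map_sub, map_add] at h2
        rw [h3]
        convert h2 using 1
        ring }
  -- The combinatorial area and the covolume are both multiplied by the determinant of `L`.
  have hA : G.totalArea U.edge ≤ 4 * ZLattice.covolume U.Λ volume := by
    have h1 : ZLattice.covolume U.Λ volume
        = |(LinearMap.det (f : ℂ →ₗ[ℝ] ℂ))⁻¹| * ZLattice.covolume R.Λ volume :=
      covolume_comap_equiv R.Λ f
    have h2 : LinearMap.det (f : ℂ →ₗ[ℝ] ℂ) = (Complex.normSq a - Complex.normSq b)⁻¹ :=
      det_realLinearEquiv_symm a b hdet.ne'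
    rw [h1, h2, inv_inv, abs_of_pos hdet]
    change G.totalArea e ≤ _
    rw [htot]
    have := mul_le_mul_of_nonneg_left R.totalArea_le hdet.le
    linarith
  exact ⟨U.toRhombicEmbedding he hA, rfl⟩

end Deformation

/-! ### Angles determine the embedding up to isometry -/

section Rigidity

namespace RhombicEmbedding

theorem angle_eq (R : RhombicEmbedding G) (d : D) :
    R.angle d = (R.edge (G.next d) / R.edge d).arg := by
  rw [angle, R.isRhombic.rot]

theorem angle_mem_Ioo (R : RhombicEmbedding G) (d : D) : R.angle d ∈ Set.Ioo 0 Real.pi :=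
  arg_mem_Ioo_of_im_pos (R.face_pos d)

theorem four_mul_area_eq_sum_sin (R : RhombicEmbedding G) :
    4 * R.area = ∑ d, Real.sin (R.angle d) := by
  rw [R.four_mul_area, R.isRhombic.totalArea_eq_sum_sin]
  simp only [angle_eq]

/-- The ratio of the edge vectors is unchanged by `rev` and, as the angles agree, by `next`;
connectedness makes it constant. -/
theorem exists_edge_eq_mul (R R' : RhombicEmbedding G) (h : R.angle = R'.angle) :
    ∃ c : ℂ, ‖c‖ = 1 ∧ ∀ d, R'.edge d = c * R.edge d := by
  obtain ⟨d₀⟩ := G.nonempty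
  have h0 := R.isRhombic.ne_zero
  have h0' := R'.isRhombic.ne_zero
  have hconst := G.eq_const (f := fun d => R'.edge d / R.edge d)
    (fun d => by simp only [R.edge_rev, R'.edge_rev, neg_div_neg_eq])
    (fun d => by
      have h1 : R.edge (G.next d) / R.edge d = R'.edge (G.next d) / R'.edge d := by
        rw [← R.isRhombic.exp_arg, ← R'.isRhombic.exp_arg, ← R.angle_eq, ← R'.angle_eq, h]
      rw [div_eq_div_iff (h0 _) (h0' _)] at h1
      rw [div_eq_div_iff (h0 _) (h0 _)]
      linear_combination -h1)
  refine ⟨R'.edge d₀ / R.edge d₀, ?_, fun d => ?_⟩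
  · rw [norm_div, R.norm_edge, R'.norm_edge, div_one]
  · rw [hconst d₀ d, div_mul_cancel₀ _ (h0 d)]

/-- Proportional edge vectors give simultaneous lifts of the vertices. -/
theorem exists_common_lift (R R' : RhombicEmbedding G) {c : ℂ}
    (h : ∀ d, R'.edge d = c * R.edge d) :
    ∃ (w : ℂ) (z : G.Vertex → ℂ), ∀ v,
      (QuotientAddGroup.mk (z v) : ℂ ⧸ R.Λ.toAddSubgroup) = R.pos v ∧
      (QuotientAddGroup.mk (c * z v + w) : ℂ ⧸ R'.Λ.toAddSubgroup) = R'.pos v := by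
  obtain ⟨d₀⟩ := G.nonempty
  let w := R'.lift d₀ - c * R.lift d₀
  have step : ∀ d, (∃ z : ℂ,
      (QuotientAddGroup.mk z : ℂ ⧸ R.Λ.toAddSubgroup) = R.pos (G.tail d) ∧
      (QuotientAddGroup.mk (c * z + w) : ℂ ⧸ R'.Λ.toAddSubgroup) = R'.pos (G.tail d)) →
      ∃ z : ℂ,
      (QuotientAddGroup.mk z : ℂ ⧸ R.Λ.toAddSubgroup) = R.pos (G.tail (G.rev d)) ∧
      (QuotientAddGroup.mk (c * z + w) : ℂ ⧸ R'.Λ.toAddSubgroup) = R'.pos (G.tail (G.rev d)) := by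
    rintro d ⟨z, h1, h2⟩
    refine ⟨z + R.edge d, ?_, ?_⟩
    · rw [R.pos_head, ← h1, QuotientAddGroup.mk_add]
    · rw [R'.pos_head, ← h2, h, ← QuotientAddGroup.mk_add]
      congr 1
      ring
  have key := G.dart_induction (p := fun d => ∃ z : ℂ,
      (QuotientAddGroup.mk z : ℂ ⧸ R.Λ.toAddSubgroup) = R.pos (G.tail d) ∧
      (QuotientAddGroup.mk (c * z + w) : ℂ ⧸ R'.Λ.toAddSubgroup) = R'.pos (G.tail d)) d₀
    ⟨R.lift d₀, R.mk_lift d₀, by simp only [w, add_sub_cancel]; exact R'.mk_lift d₀⟩ step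
    (fun d hd => by simp only [tail_next]; exact step d hd)
  have key' : ∀ v : G.Vertex, ∃ z : ℂ,
      (QuotientAddGroup.mk z : ℂ ⧸ R.Λ.toAddSubgroup) = R.pos v ∧
      (QuotientAddGroup.mk (c * z + w) : ℂ ⧸ R'.Λ.toAddSubgroup) = R'.pos v := fun v => by
    induction v using Quotient.inductionOn with | h d => exact key d
  choose z hz using key'
  exact ⟨w, z, hz⟩

/-- A subgroup of the plane which contains all periods of a rhombic cocycle spans the plane. -/
theorem span_eq_top_of_periods {e : D → ℂ} (he : G.IsRhombic e) (Λ : Submodule ℤ ℂ)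
    (z : G.Vertex → ℂ) (hz : ∀ d, z (G.tail d) + e d - z (G.tail (G.rev d)) ∈ Λ) :
    Submodule.span ℝ (Λ : Set ℂ) = ⊤ := by
  by_contra hne
  obtain ⟨f, hf, hker⟩ := Submodule.exists_le_ker_of_lt_top _ (lt_top_iff_ne_top.2 hne)
  have hfd : ∀ d, f (e d) = f (z (G.tail (G.rev d))) - f (z (G.tail d)) := by
    intro d
    have : f (z (G.tail d) + e d - z (G.tail (G.rev d))) = 0 :=
      hker (Submodule.subset_span (hz d))
    rw [map_sub, map_add] at this
    linarith
  have hfz : ∀ x : ℂ, f x = x.re * f 1 + x.im * f Complex.I := by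
    intro x
    have hx : x = x.re • (1 : ℂ) + x.im • Complex.I := by simp [Complex.re_add_im]
    conv_lhs => rw [hx]
    rw [map_add, map_smul, map_smul, smul_eq_mul, smul_eq_mul]
  set α : ℂ := ((f 1 : ℂ) - Complex.I * f Complex.I) / 2 with hα
  set α' : ℂ := ((f 1 : ℂ) + Complex.I * f Complex.I) / 2 with hα'
  -- A nonzero functional `f` killing the lattice would make `f ∘ e` a coboundary, whereas `e` and
  -- `star e` are independent in cohomology.
  have hdec : G.coboundary (fun v => (f (z v) : ℂ)) = α • e + α' • star e := by
    ext d
    simp only [coboundary, Pi.add_apply, Pi.smul_apply, smul_eq_mul, Pi.star_apply]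
    rw [← Complex.ofReal_sub, ← hfd, hfz, hα, hα', Complex.star_def]
    conv_rhs => rw [← Complex.re_add_im (e d)]
    simp only [map_add, map_mul, Complex.conj_ofReal, Complex.conj_I]
    push_cast
    linear_combination ((e d).im * f Complex.I : ℂ) * Complex.I_sq
  have h0 := pair_coboundary he.1 (fun v => (f (z v) : ℂ))
  rw [hdec, pair_add_left, pair_smul_left, pair_smul_left, pair_self he.1,
    pair_antisymm he.1.star, pair_star_self he.1] at h0
  have hS : (G.totalArea e : ℂ) ≠ 0 := by exact_mod_cast he.totalArea_pos.ne'
  have hα0 : α' = 0 := by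
    simpa [hS] using h0
  rw [hα', div_eq_zero_iff] at hα0
  have h2 := hα0.resolve_right two_ne_zero
  have hre := congrArg Complex.re h2
  have him := congrArg Complex.im h2
  simp at hre him
  refine hf (LinearMap.ext fun x => ?_)
  rw [hfz, hre, him]
  simp

/-- The common part `Λ'` of `R.Λ` and the preimage of `R'.Λ` contains all periods, so the same edges
give a drawing on its torus. Its faces still cover, so the covolume of `Λ'` is at most that of
`R.Λ`; an index at most one means equality. -/
theorem mul_mem_of_edge_eq_mul (R R' : RhombicEmbedding G) {c : ℂ}
    (h : ∀ d, R'.edge d = c * R.edge d) {x : ℂ} (hx : x ∈ R.Λ) : c * x ∈ R'.Λ := by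
  obtain ⟨w, z, hz⟩ := exists_common_lift R R' h
  have := R.discrete
  have := R.lattice
  let Λ' : Submodule ℤ ℂ :=
    R.Λ ⊓ R'.Λ.comap ((LinearMap.mulLeft ℝ c).restrictScalars ℤ)
  have hle : Λ' ≤ R.Λ := inf_le_left
  have hper : ∀ d, z (G.tail d) + R.edge d - z (G.tail (G.rev d)) ∈ Λ' := by
    intro d
    constructor
    · have h1 : (QuotientAddGroup.mk (z (G.tail (G.rev d))) : ℂ ⧸ R.Λ.toAddSubgroup)
          = QuotientAddGroup.mk (z (G.tail d) + R.edge d) := by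
        rw [QuotientAddGroup.mk_add, (hz _).1, (hz _).1, R.pos_head]
      exact UnitDrawing.mk_eq_mk_iff.1 h1
    · have h1 : (QuotientAddGroup.mk (c * z (G.tail (G.rev d)) + w) : ℂ ⧸ R'.Λ.toAddSubgroup)
          = QuotientAddGroup.mk (c * z (G.tail d) + w + R'.edge d) := by
        rw [(hz _).2, R'.pos_head, ← (hz _).2, ← QuotientAddGroup.mk_add]
      have h2 := UnitDrawing.mk_eq_mk_iff.1 h1
      change c * (z (G.tail d) + R.edge d - z (G.tail (G.rev d))) ∈ R'.Λ
      rw [h] at h2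
      convert h2 using 1
      ring
  have hdisc : DiscreteTopology Λ' := DiscreteTopology.of_subset (t := (Λ' : Set ℂ)) R.discrete hle
  have hlat : IsZLattice ℝ Λ' := ⟨span_eq_top_of_periods R.isRhombic Λ' z hper⟩
  let U : UnitDrawing G :=
    { Λ := Λ'
      discrete := hdisc
      lattice := hlat
      pos := fun v => QuotientAddGroup.mk (z v)
      edge := R.edge
      norm_edge := R.norm_edge
      edge_rev := R.edge_rev
      pos_head := fun d => by
        rw [← QuotientAddGroup.mk_add, QuotientAddGroup.eq, neg_add_eq_sub]
        exact hper d }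
  have h1 : 4 * ZLattice.covolume Λ' volume ≤ G.totalArea R.edge :=
    UnitDrawing.four_mul_covolume_le (U := U) R.isRhombic
  have h2 := R.totalArea_le
  have hidx := ZLattice.covolume_div_covolume_eq_relIndex' Λ' R.Λ hle
  have p1 := ZLattice.covolume_pos Λ' volume
  have p2 := ZLattice.covolume_pos R.Λ volume
  have hone : Λ'.toAddSubgroup.relIndex R.Λ.toAddSubgroup = 1 := by
    have q1 : (0 : ℝ) < Λ'.toAddSubgroup.relIndex R.Λ.toAddSubgroup := by
      rw [← hidx]; exact div_pos p1 p2
    have q2 : (Λ'.toAddSubgroup.relIndex R.Λ.toAddSubgroup : ℝ) ≤ 1 := by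
      rw [← hidx, div_le_one p2]; linarith
    have q3 : 0 < Λ'.toAddSubgroup.relIndex R.Λ.toAddSubgroup := by exact_mod_cast q1
    have q4 : Λ'.toAddSubgroup.relIndex R.Λ.toAddSubgroup ≤ 1 := by exact_mod_cast q2
    omega
  have hmem : x ∈ Λ'.toAddSubgroup := AddSubgroup.relIndex_eq_one.1 hone hx
  exact hmem.2

/-- A rhombic embedding is determined by its angles up to an orientation-preserving isometry. -/
theorem congruent_of_angle_eq (R R' : RhombicEmbedding G) (h : R.angle = R'.angle) :
    R.Congruent R' := by
  obtain ⟨c, hc, he⟩ := exists_edge_eq_mul R R' h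
  have hc0 : c ≠ 0 := by rintro rfl; simp at hc
  have he' : ∀ d, R.edge d = c⁻¹ * R'.edge d := fun d => by rw [he, inv_mul_cancel_left₀ hc0]
  have hΛ : ∀ z : ℂ, z ∈ R.Λ ↔ c * z ∈ R'.Λ := fun z =>
    ⟨mul_mem_of_edge_eq_mul R R' he, fun hz => by
      simpa [hc0] using mul_mem_of_edge_eq_mul R' R he' hz⟩
  obtain ⟨w, z, hz⟩ := exists_common_lift R R' he
  refine ⟨c, w, hc, hΛ, he, fun v x hx => ?_⟩
  rw [← (hz v).1, UnitDrawing.mk_eq_mk_iff, hΛ] at hx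
  rw [← (hz v).2, UnitDrawing.mk_eq_mk_iff]
  convert hx using 1
  ring

end RhombicEmbedding

end Rigidity

end TorusQuadrangulation

namespace TorusQuadrangulation

open MeasureTheory

variable {D : Type*} [Fintype D] {G : TorusQuadrangulation D}

/-! ### Convexity, concavity and the maximizer -/

theorem convex_Rh : Convex ℝ G.Rh := by
  rintro _ ⟨R, rfl⟩ _ ⟨R', rfl⟩ r s hr hs hrs
  obtain ⟨e, he, hangle⟩ := R.isRhombic.exists_interpolation R'.isRhombic hr hs hrs
  obtain ⟨R'', hR''⟩ := R.exists_edge_eq he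
  refine ⟨R'', funext fun d => ?_⟩
  simp only [R''.angle_eq, hR'', hangle, Pi.add_apply, Pi.smul_apply, R.angle_eq, R'.angle_eq,
    smul_eq_mul]

theorem strictConcaveOn_sum_sin :
    StrictConcaveOn ℝ G.Rh fun θ => (∑ d, Real.sin (θ d)) / 4 := by
  refine ⟨convex_Rh, ?_⟩
  rintro _ ⟨R, rfl⟩ _ ⟨R', rfl⟩ hne r s hr hs hrs
  have hIcc : ∀ (R : RhombicEmbedding G) d, R.angle d ∈ Set.Icc 0 Real.pi := fun R d =>
    Set.Ioo_subset_Icc_self (R.angle_mem_Ioo d)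
  obtain ⟨d₀, hd₀⟩ := Function.ne_iff.1 hne
  have hlt : ∑ d, (r * Real.sin (R.angle d) + s * Real.sin (R'.angle d))
      < ∑ d, Real.sin (r * R.angle d + s * R'.angle d) := by
    refine Finset.sum_lt_sum (fun d _ => ?_) ⟨d₀, Finset.mem_univ _, ?_⟩
    · exact strictConcaveOn_sin_Icc.concaveOn.2 (hIcc R d) (hIcc R' d) hr.le hs.le hrs
    · exact strictConcaveOn_sin_Icc.2 (hIcc R d₀) (hIcc R' d₀) hd₀ hr hs hrs
  rw [Finset.sum_add_distrib, ← Finset.mul_sum, ← Finset.mul_sum] at hlt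
  simp only [smul_eq_mul, Pi.add_apply, Pi.smul_apply]
  linarith

namespace RhombicEmbedding

theorem area_eq (R : RhombicEmbedding G) : (∑ d, Real.sin (R.angle d)) / 4 = R.area := by
  rw [← R.four_mul_area_eq_sum_sin, mul_div_cancel_left₀ _ (by norm_num)]

theorem area_le_iff (R R' : RhombicEmbedding G) :
    R.area ≤ R'.area ↔ G.totalArea R.edge ≤ G.totalArea R'.edge := by
  rw [← R.four_mul_area, ← R'.four_mul_area]
  constructor <;> intro h <;> linarith

theorem inner_transversal_eq_zero_iff (R : RhombicEmbedding G) (d : D) :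
    inner ℝ (R.transversal (G.track d)) (R.asymptoticDirection (G.track d)) = 0 ↔
      (star (R.edge d) * trackSum R.edge (G.track d)).re = 0 := by
  have ht : R.transversal (G.track d) = -R.edge d := rfl
  rw [asymptoticDirection, inner_smul_right, ht, inner_neg_left, asymptoticVector_eq]
  have hn : ‖trackSum R.edge (G.track d)‖⁻¹ ≠ 0 :=
    inv_ne_zero (norm_ne_zero_iff.2 (R.isRhombic.trackSum_ne_zero d))
  have hi : inner ℝ (R.edge d) (trackSum R.edge (G.track d))
      = (star (R.edge d) * trackSum R.edge (G.track d)).re := by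
    rw [Complex.inner, Complex.star_def, mul_comm]
  rw [hi, mul_eq_zero, neg_eq_zero]
  exact ⟨fun h => h.resolve_left hn, Or.inr⟩

theorem exists_isAreaMaximizer (R : RhombicEmbedding G) :
    ∃ R₀ : RhombicEmbedding G, R₀.IsAreaMaximizer ∧
      ∀ c, G.IsParallelogramCocycle c → (∀ d, ‖c d‖ = 1) →
        G.totalArea c ≤ G.totalArea R₀.edge := by
  obtain ⟨e, he, hmax⟩ := R.isRhombic.exists_isMax
  obtain ⟨R₀, rfl⟩ := R.exists_edge_eq he
  exact ⟨R₀, fun R' => (area_le_iff R' R₀).2 (hmax _ R'.isRhombic.1 R'.norm_edge), hmax⟩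

theorem angle_eq_of_isAreaMaximizer {R R' : RhombicEmbedding G} (h : R.IsAreaMaximizer)
    (h' : R'.IsAreaMaximizer) : R.angle = R'.angle := by
  refine strictConcaveOn_sum_sin.eq_of_isMaxOn ?_ ?_ ⟨R, rfl⟩ ⟨R', rfl⟩
  · rintro _ ⟨R'', rfl⟩
    simpa only [Set.mem_ofPred_eq, area_eq] using h R''
  · rintro _ ⟨R'', rfl⟩
    simpa only [Set.mem_ofPred_eq, area_eq] using h' R''

theorem isAreaMaximizer_iff (R : RhombicEmbedding G) : R.IsAreaMaximizer ↔
    ∀ t : G.OrientedTrainTrack, inner ℝ (R.transversal t) (R.asymptoticDirection t) = 0 := by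
  constructor
  · intro h t
    induction t using Quotient.inductionOn with | h d => ?_
    refine (R.inner_transversal_eq_zero_iff d).2 ?_
    -- The variation of one track may leave the rhombic cocycles. Comparison with `R₀` upgrades
    -- maximality among embeddings to maximality among all unit parallelogram cocycles.
    obtain ⟨R₀, -, hmax⟩ := R.exists_isAreaMaximizer
    have hle := (area_le_iff R₀ R).1 (h R₀)
    rw [star_mul_trackSum_of_isMax R.isRhombic.1 R.norm_edge
      (fun c hc hn => (hmax c hc hn).trans hle) d]
    simp
  · intro h R'
    exact (area_le_iff R' R).2 (R.isRhombic.totalArea_le_of_orthogonal R'.isRhombic fun d =>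
      (R.inner_transversal_eq_zero_iff d).1 (h _))

end RhombicEmbedding

end TorusQuadrangulation

theorem mainTheorem3 {D : Type*} [Fintype D] (G : TorusQuadrangulation D)
    (hG : Nonempty G.RhombicEmbedding) :
    (∃ A : (D → ℝ) → ℝ, (∀ R : G.RhombicEmbedding, A R.angle = R.area) ∧
      StrictConcaveOn ℝ G.Rh A) ∧
    (∃ R₀ : G.RhombicEmbedding, R₀.IsAreaMaximizer ∧
      ∀ R : G.RhombicEmbedding, R.IsAreaMaximizer → R₀.Congruent R) ∧
    (∀ R : G.RhombicEmbedding, R.IsAreaMaximizer ↔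
      ∀ t : G.OrientedTrainTrack, inner ℝ (R.transversal t) (R.asymptoticDirection t) = 0) := by
  obtain ⟨R⟩ := hG
  obtain ⟨R₀, hR₀, -⟩ := R.exists_isAreaMaximizer
  exact ⟨⟨_, fun R => R.area_eq, TorusQuadrangulation.strictConcaveOn_sum_sin⟩,
    ⟨R₀, hR₀, fun R' hR' => R₀.congruent_of_angle_eq R'
      (TorusQuadrangulation.RhombicEmbedding.angle_eq_of_isAreaMaximizer hR₀ hR')⟩,
    fun R => R.isAreaMaximizer_iff⟩
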